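/- Theorem 2.2. Let $\mathbb{X}\subseteq\mathbb{R}_+=[0,\infty)$ be a measurable unbounded set, and let $\Xi=(\xi_n)_{n\ge 0}$ be a time-homogeneous Markov chain on $\mathbb{X}$. Write $\mathbb{P}_x,\mathbb{E}_x$ for probability and expectation when $\xi_0=x$, and put $\theta=\xi_1-\xi_0$, $\theta_+=\max(\theta,0)$, $\theta_-=\max(-\theta,0)$, $\mu(x)=\mathbb{E}_x[\theta]$, and $\tau_a=\min\{n\ge 0:\xi_n\le a\}$ (with $\min\emptyset=\infty$). Suppose that for some constants $\alpha\in(1,2)$, $\beta>\alpha$, $c>0$, $x_0\ge 0$, $\gamma\ge 0$, $b\in\mathbb{R}$, with $x$ ranging over $\mathbb{X}$, $$\lim_{y\to\infty}\sup_{x\ge x_0}\bigl|y^\alpha\,\mathbb{P}_x[\theta_+>y]-c\bigr|=0,\qquad \sup_{x\ge x_0}\mathbb{E}_x[\theta_-^\beta]<\infty,\qquad \lim_{x\to\infty}x^\gamma\mu(x)=b .$$ Let $q>0$. Then for all $a$ sufficiently large (depending on $q$) and all $x\in\mathbb{X}$ with $x>a$, the following hold. (i) If $\gamma>\alpha-1$,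 then $\mathbb{E}_x[\tau_a^q]<\infty$ for $q<1/\alpha$ and $\mathbb{E}_x[\tau_a^q]=\infty$ for $q>1/\alpha$. (ii) If $\gamma=\alpha-1$ and $b<c\pi\,|\operatorname{cosec}(\pi\alpha)|$, then the equation $$\frac{b}{c}=(\nu-1)\,\frac{\Gamma(1-\alpha)\,\Gamma(\alpha-\nu)}{\Gamma(2-\nu)}$$ has a unique solution $\nu=\nu^\star$ in $(0,\alpha)$, and $\mathbb{E}_x[\tau_a^q]<\infty$ for $q<\nu^\star/\alpha$ and $\mathbb{E}_x[\tau_a^q]=\infty$ for $q>\nu^\star/\alpha$. (iii) If $\gamma<\alpha-1$ and $b<0$, then $\mathbb{E}_x[\tau_a^q]<\infty$ for $q<\alpha/(\gamma+1)$ and $\mathbb{E}_x[\tau_a^q]=\infty$ for $q\ge\alpha/(\gamma+1)$. -/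

import Mathlib

open Set Filter Topology MeasureTheory ProbabilityTheory
open scoped ENNReal

namespace HalfLineChain

/-- The transition mechanism of the time-homogeneous chain in Ionescu-Tulcea form: given the
history up to time `n`, the next state has law `P (ξ n)`. -/
noncomputable def step {X : Set ℝ} (P : Kernel X X) (n : ℕ) :
    Kernel (Π _ : Finset.Iic n, X) X :=
  P.comap (fun h => h ⟨n, Finset.mem_Iic.2 le_rfl⟩) (measurable_pi_apply _)

instance {X : Set ℝ} (P : Kernel X X) [IsMarkovKernel P] (n : ℕ) : IsMarkovKernel (step P n) := by
  unfold step; infer_instance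

/-- The law `ℙ_x` on trajectories `ℕ → X` of the time-homogeneous Markov chain with transition
kernel `P` started from `ξ 0 = x`. -/
noncomputable def pathLaw {X : Set ℝ} (P : Kernel X X) [IsMarkovKernel P] (x : X) :
    Measure (ℕ → X) :=
  Kernel.traj (X := fun _ => X) (step P) 0 (fun _ => x)

/-- The passage time `τ_a = min {n ≥ 0 : ξ n ≤ a}`, equal to `∞` if there is no such `n`. -/
noncomputable def passageTime {X : Set ℝ} (a : ℝ) : (ℕ → X) → ℕ∞ :=
  hittingAfter (fun n (ξ : ℕ → X) => (ξ n : ℝ)) (Iic a) 0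

/-- The moment `𝔼_x[τ_a ^ q] ∈ [0, ∞]`. -/
noncomputable def passageMoment {X : Set ℝ} (P : Kernel X X) [IsMarkovKernel P]
    (a q : ℝ) (x : X) : ℝ≥0∞ :=
  ∫⁻ ξ, (passageTime a ξ : ℝ≥0∞) ^ q ∂(pathLaw P x)

/-- The mean drift `μ(x) = 𝔼_x[θ]`, where `θ = ξ 1 - ξ 0`; under `ℙ_x` the law of `ξ 1` is `P x`.
Under `TailCondition` the increment is integrable for all large `x`, and only those
values of `x` matter in `DriftCondition`. -/
noncomputable def drift {X : Set ℝ} (P : Kernel X X) (x : X) : ℝ :=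
  ∫ z, ((z : ℝ) - x) ∂(P x)

/-- The tail condition: uniformly over the states `x ≥ x₀`, `y ^ α * ℙ_x(θ₊ > y) → c`
as `y → ∞`, and `sup_{x ≥ x₀} 𝔼_x[θ₋ ^ β] < ∞`. -/
structure TailCondition {X : Set ℝ} (P : Kernel X X) (α β c : ℝ) : Prop where
  one_lt : 1 < α
  lt_two : α < 2
  alpha_lt_beta : α < β
  c_pos : 0 < c
  tails : ∃ x₀ : ℝ, 0 ≤ x₀ ∧
    TendstoUniformlyOn
      (fun (y : ℝ) (x : X) => y ^ α * (P x).real {z : X | y < max ((z : ℝ) - x) 0})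
      (fun _ => c) atTop {x : X | x₀ ≤ (x : ℝ)} ∧
    (⨆ x : X, ⨆ _ : x₀ ≤ (x : ℝ),
      ∫⁻ z : X, ENNReal.ofReal (max (-((z : ℝ) - x)) 0 ^ β) ∂(P x)) < ⊤

/-- The drift condition: `x ^ γ * μ(x) → b` as `x → ∞` within the state space, with `γ ≥ 0`. -/
structure DriftCondition {X : Set ℝ} (P : Kernel X X) (γ b : ℝ) : Prop where
  gamma_nonneg : 0 ≤ γ
  tendsto : Tendsto (fun x : X => (x : ℝ) ^ γ * drift P x)
    (comap (fun x : X => (x : ℝ)) atTop) (𝓝 b)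

/-- `ν` is a root in `(0, α)` of `b / c = (ν - 1) Γ(1 - α) Γ(α - ν) / Γ(2 - ν)`. -/
def IsCriticalRoot (α b c ν : ℝ) : Prop :=
  0 < ν ∧ ν < α ∧
    b / c = (ν - 1) * (Real.Gamma (1 - α) * Real.Gamma (α - ν) / Real.Gamma (2 - ν))

end HalfLineChain

/-! The functions x^ν with 0 < ν < α decide everything. Expanding in the relative jump θ/x gives, as
x → ∞, 𝔼_x[ξ₁^ν] / x^ν - 1 = ν μ(x) / x + c ν I(ν) x^(-α) + o(x^(-α)), where I(ν) is `stableDrift α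
ν` (`tendsto_rpow_drift`). Upward jumps produce I through their regularly varying tail; downward
jumps matter only through the mean, since a moment of order above α makes their remainder
negligible. I is strictly increasing, vanishes at ν = 1, and an integration by parts expresses it by
Gamma functions, so the equation for ν⋆ reads b + c I(ν) = 0.

If γ = α - 1, both terms have order x^(-α) and their sum changes sign at ν⋆. If γ > α - 1, the mean
is negligible and the same argument runs with b = 0, ν⋆ = 1. If γ < α - 1 and b < 0, the mean
dominates, and the relative drift is of order -x^(-(γ+1)) for every ν < α.

Finite moments: relative drift at most -ε x^(-δ) forces ℙ_x(τ > n) = O(n^(-p)) for each p < ν/δ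
(`survival_le_of_lyapunov`), and a dyadic sum bounds the moments.

Infinite moments, critical case: for ν slightly above ν⋆ the drift of x^ν is positive. Saturated at
a scale of order n^(1/α), the function becomes bounded and loses at most a fraction O(1/n) per step,
so ℙ_x(τ > n) is at least of order n^(-ν/α) (`exists_le_survival`).

Infinite moments, dominant mean: one jump to height of order n^(1/(γ+1)) has probability of order
n^(-α/(γ+1)), and from there the descent outlasts n steps with probability at least 1/2
(`exists_half_le_survival`). As no exponent is lost here, the boundary q = α/(γ+1) is included. -/

namespace HalfLineChain

variable {X : Set ℝ}

/-! ### Survival probabilities and passage-time moments -/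

/-- The transition operator of the chain killed on leaving `(a, ∞)`. -/
noncomputable def killedStep (P : Kernel X X) (a : ℝ) (g : X → ℝ≥0∞) (x : X) : ℝ≥0∞ :=
  ∫⁻ z in {z : X | a < (z : ℝ)}, g z ∂(P x)

/-- `ℙ_x(τ_a > n)` for `x > a`, expressed through the killed transition operator. -/
noncomputable def survival (P : Kernel X X) (a : ℝ) (n : ℕ) : X → ℝ≥0∞ :=
  (killedStep P a)^[n] 1

lemma measurableSet_above (a : ℝ) : MeasurableSet {z : X | a < (z : ℝ)} :=
  measurableSet_lt measurable_const measurable_subtype_coe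

lemma measurable_killedStep (P : Kernel X X) [IsMarkovKernel P] (a : ℝ) {g : X → ℝ≥0∞} (hg : Measurable g) :
    Measurable (killedStep P a g) :=
  hg.setLIntegral_kernel (measurableSet_above a)

lemma killedStep_mono (P : Kernel X X) (a : ℝ) {g h : X → ℝ≥0∞}
    (hgh : ∀ z : X, a < (z : ℝ) → g z ≤ h z) (x : X) :
    killedStep P a g x ≤ killedStep P a h x :=
  setLIntegral_mono' (measurableSet_above a) fun z hz => hgh z hz

lemma survival_zero (P : Kernel X X) (a : ℝ) (x : X) : survival P a 0 x = 1 := rfl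

lemma survival_succ (P : Kernel X X) (a : ℝ) (n : ℕ) (x : X) :
    survival P a (n + 1) x = killedStep P a (survival P a n) x := by
  simp only [survival, Function.iterate_succ', Function.comp]

lemma measurable_survival (P : Kernel X X) [IsMarkovKernel P] (a : ℝ) (n : ℕ) : Measurable (survival P a n) := by
  induction n with
  | zero => exact measurable_const
  | succ n ih =>
    have : survival P a (n + 1) = killedStep P a (survival P a n) := funext (survival_succ P a n)
    rw [this]; exact measurable_killedStep P a ih

/-- The Markov property at time `n`, for functionals of the form `F (ξ 0, …, ξ n) * g (ξ (n+1))`. -/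
lemma lintegral_pathLaw_succ (P : Kernel X X) [IsMarkovKernel P] (x : X) (n : ℕ)
    {F : (Π _ : Finset.Iic n, X) → ℝ≥0∞} (hF : Measurable F) {g : X → ℝ≥0∞} (hg : Measurable g) :
    ∫⁻ ξ, F (Preorder.frestrictLe n ξ) * g (ξ (n + 1)) ∂(pathLaw P x) =
      ∫⁻ ξ, F (Preorder.frestrictLe n ξ) * ∫⁻ z, g z ∂(P (ξ n)) ∂(pathLaw P x) := by
  have hg' : Measurable fun y => ∫⁻ z, g z ∂(P y) := hg.lintegral_kernel
  have h0 : pathLaw P x = (Kernel.traj (X := fun _ => X) (step P) n ∘ₖ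
      Kernel.partialTraj (X := fun _ => X) (step P) 0 n) (fun _ => x) := by
    rw [Kernel.traj_comp_partialTraj (Nat.zero_le n)]; rfl
  have key : ∀ h : Π _ : Finset.Iic n, X,
      ∫⁻ ξ, F (Preorder.frestrictLe n ξ) * g (ξ (n + 1))
        ∂(Kernel.traj (X := fun _ => X) (step P) n h) =
      ∫⁻ ξ, F (Preorder.frestrictLe n ξ) * ∫⁻ z, g z ∂(P (ξ n))
        ∂(Kernel.traj (X := fun _ => X) (step P) n h) := by
    intro h
    -- Given the history `h`, the coordinates up to time `n` are frozen at `h`, so `F` and the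
    -- kernel integral are almost surely constant.
    have hmap : (Kernel.traj (X := fun _ => X) (step P) n h).map (Preorder.frestrictLe n) =
        Measure.dirac h := by
      rw [Kernel.traj_map_frestrictLe_apply, Kernel.partialTraj_self, Kernel.id_apply]
    have hae : ∀ᵐ ξ ∂(Kernel.traj (X := fun _ => X) (step P) n h),
        F (Preorder.frestrictLe n ξ) = F h ∧
          (∫⁻ z, g z ∂(P (ξ n))) = ∫⁻ z, g z ∂(P (h ⟨n, Finset.mem_Iic.2 le_rfl⟩)) := by
      have h1 : ∀ᵐ y ∂(Measure.dirac h), F y = F h ∧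
          (∫⁻ z, g z ∂(P (y ⟨n, Finset.mem_Iic.2 le_rfl⟩))) =
            ∫⁻ z, g z ∂(P (h ⟨n, Finset.mem_Iic.2 le_rfl⟩)) := by
        rw [ae_dirac_iff]
        · exact ⟨rfl, rfl⟩
        · exact (measurableSet_eq_fun hF measurable_const).inter
            (measurableSet_eq_fun (hg'.comp (measurable_pi_apply _)) measurable_const)
      rw [← hmap] at h1
      exact ae_of_ae_map (Preorder.measurable_frestrictLe n).aemeasurable h1
    rw [lintegral_congr_ae (f := fun ξ : ℕ → X => F (Preorder.frestrictLe n ξ) * g (ξ (n + 1)))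
        (g := fun ξ : ℕ → X => F h * g (ξ (n + 1))) (by filter_upwards [hae] with ξ hξ; simp only [hξ.1]),
      lintegral_congr_ae (f := fun ξ : ℕ → X => F (Preorder.frestrictLe n ξ) * ∫⁻ z, g z ∂(P (ξ n)))
        (g := fun _ : ℕ → X => F h * ∫⁻ z, g z ∂(P (h ⟨n, Finset.mem_Iic.2 le_rfl⟩)))
        (by filter_upwards [hae] with ξ hξ; simp only [hξ.1, hξ.2]),
      lintegral_const_mul _ (show Measurable fun ξ : ℕ → X => g (ξ (n + 1)) from
        hg.comp (measurable_pi_apply _)), lintegral_const, measure_univ,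
      mul_one]
    congr 1
    have hs := Kernel.map_traj_succ_self (X := fun _ => X) (κ := step P) (a := n)
    have hs' := DFunLike.congr_fun hs h
    rw [Kernel.map_apply _ (measurable_pi_apply _)] at hs'
    rw [← lintegral_map (μ := Kernel.traj (X := fun _ => X) (step P) n h)
      (g := fun ξ : ℕ → X => ξ (n + 1)) hg (measurable_pi_apply _), hs']
    rfl
  have hm1 : Measurable fun ξ : ℕ → X => F (Preorder.frestrictLe n ξ) * g (ξ (n + 1)) :=
    (hF.comp (Preorder.measurable_frestrictLe n)).mul (hg.comp (measurable_pi_apply _))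
  have hm2 : Measurable fun ξ : ℕ → X => F (Preorder.frestrictLe n ξ) * ∫⁻ z, g z ∂(P (ξ n)) :=
    (hF.comp (Preorder.measurable_frestrictLe n)).mul (hg'.comp (measurable_pi_apply _))
  rw [h0, Kernel.lintegral_comp _ _ _ hm1, Kernel.lintegral_comp _ _ _ hm2]
  exact lintegral_congr key

lemma pathLaw_eval_zero (P : Kernel X X) [IsMarkovKernel P] (x : X) :
    ∀ᵐ ξ ∂(pathLaw P x), ξ 0 = x := by
  have hmap : (pathLaw P x).map (Preorder.frestrictLe (π := fun _ => X) 0) =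
      Measure.dirac (fun _ => x) := by
    unfold pathLaw
    rw [Kernel.traj_map_frestrictLe_apply, Kernel.partialTraj_self, Kernel.id_apply]
  have hm : Measurable fun y : (Π _ : Finset.Iic 0, X) =>
      ((y ⟨0, Finset.mem_Iic.2 le_rfl⟩ : X) : ℝ) :=
    measurable_subtype_coe.comp (measurable_pi_apply _)
  have h1 : ∀ᵐ y ∂(Measure.dirac (fun _ : Finset.Iic 0 => x)),
      ((y ⟨0, Finset.mem_Iic.2 le_rfl⟩ : X) : ℝ) = x := by
    rw [ae_dirac_iff (measurableSet_eq_fun hm measurable_const)]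
  rw [← hmap] at h1
  filter_upwards [ae_of_ae_map (Preorder.measurable_frestrictLe 0).aemeasurable h1] with ξ hξ
  exact Subtype.ext hξ

instance (P : Kernel X X) [IsMarkovKernel P] (x : X) : IsProbabilityMeasure (pathLaw P x) := by
  unfold pathLaw; infer_instance

/-- The Markov property absorbs the last coordinate into `killedStep P a g`, evaluated one step
earlier; hence the induction over an arbitrary terminal function `g`. -/
lemma lintegral_alive_eq_iterate (P : Kernel X X) [IsMarkovKernel P] {a : ℝ} {x : X}
    (hx : a < (x : ℝ)) (n : ℕ) {g : X → ℝ≥0∞} (hg : Measurable g) :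
    ∫⁻ ξ, {h : Π _ : Finset.Iic n, X | ∀ k, a < (h k : ℝ)}.indicator 1
        (Preorder.frestrictLe n ξ) * g (ξ n) ∂(pathLaw P x) = (killedStep P a)^[n] g x := by
  have hmeas : ∀ m : ℕ, MeasurableSet {h : Π _ : Finset.Iic m, X | ∀ k, a < (h k : ℝ)} := by
    intro m
    rw [show {h : Π _ : Finset.Iic m, X | ∀ k, a < (h k : ℝ)} =
      ⋂ k, {h : Π _ : Finset.Iic m, X | a < (h k : ℝ)} by ext; simp]
    exact MeasurableSet.iInter fun k => measurableSet_lt measurable_const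
      (measurable_subtype_coe.comp (measurable_pi_apply k))
  induction n generalizing g with
  | zero =>
    rw [lintegral_congr_ae (g := fun _ => g x)]
    · simp
    · filter_upwards [pathLaw_eval_zero P x] with ξ hξ
      rw [indicator_of_mem, hξ]
      · simp
      · rintro ⟨k, hk⟩
        obtain rfl : k = 0 := by simpa using hk
        simpa [hξ] using hx
  | succ n ih =>
    rw [Function.iterate_succ, Function.comp_apply, ← ih (measurable_killedStep P a hg)]
    refine Eq.trans ?_ ((lintegral_pathLaw_succ P x n
        (measurable_one.indicator (hmeas n)) (hg.indicator (measurableSet_above a))).trans ?_)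
    · refine lintegral_congr fun ξ => ?_
      by_cases h1 : a < (ξ (n + 1) : ℝ) <;> by_cases h2 : ∀ k : ℕ, k ≤ n → a < (ξ k : ℝ)
      · rw [indicator_of_mem, indicator_of_mem, indicator_of_mem]
        · rfl
        · exact h1
        · rintro ⟨k, hk⟩; exact h2 k (Finset.mem_Iic.1 hk)
        · rintro ⟨k, hk⟩
          rcases Nat.le_succ_iff.1 (Finset.mem_Iic.1 hk) with h | rfl
          · exact h2 k h
          · exact h1
      · rw [indicator_of_notMem, indicator_of_notMem]
        · simp
        · intro h; exact h2 fun k hk => h ⟨k, Finset.mem_Iic.2 hk⟩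
        · intro h; exact h2 fun k hk => h ⟨k, Finset.mem_Iic.2 (hk.trans n.le_succ)⟩
      all_goals
        rw [indicator_of_notMem, indicator_of_notMem (a := ξ (n + 1))]
        · simp
        · exact h1
        · intro h; exact h1 (h ⟨n + 1, Finset.mem_Iic.2 le_rfl⟩)
    · refine lintegral_congr fun ξ => ?_
      rw [lintegral_indicator (measurableSet_above a)]
      rfl

lemma lt_passageTime_iff (a : ℝ) (n : ℕ) (ξ : ℕ → X) :
    (n : ℕ∞) < passageTime a ξ ↔ ∀ k ≤ n, a < (ξ k : ℝ) := by
  have := hittingAfter_le_iff (u := fun n (ξ : ℕ → X) => (ξ n : ℝ)) (s := Iic a) (n := 0) (i := n)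
    (ω := ξ)
  unfold passageTime
  constructor
  · intro h k hk
    have h1 : ((k : ℕ) : WithTop ℕ) < hittingAfter (fun n (ξ : ℕ → X) => (ξ n : ℝ)) (Iic a) 0 ξ :=
      lt_of_le_of_lt (WithTop.coe_le_coe.2 hk) h
    simpa using notMem_of_lt_hittingAfter h1 (Nat.zero_le k)
  · intro h
    by_contra hcon
    obtain ⟨k, hk, hk'⟩ := this.1 (not_lt.1 hcon)
    exact absurd (h k (by simpa using hk.2)) (not_lt.2 hk')

lemma measurableSet_lt_passageTime (a : ℝ) (n : ℕ) :
    MeasurableSet {ξ : ℕ → X | (n : ℕ∞) < passageTime a ξ} := by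
  have : {ξ : ℕ → X | (n : ℕ∞) < passageTime a ξ} = ⋂ k ∈ Iic n, {ξ : ℕ → X | a < (ξ k : ℝ)} := by
    ext ξ; simpa using lt_passageTime_iff a n ξ
  rw [this]
  exact MeasurableSet.biInter (to_countable _) fun k _ => measurableSet_lt measurable_const
    (measurable_subtype_coe.comp (measurable_pi_apply k))

lemma pathLaw_lt_passageTime (P : Kernel X X) [IsMarkovKernel P] {a : ℝ} {x : X}
    (hx : a < (x : ℝ)) (n : ℕ) :
    pathLaw P x {ξ | (n : ℕ∞) < passageTime a ξ} = survival P a n x := by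
  rw [survival, ← lintegral_alive_eq_iterate P hx n measurable_one,
    ← lintegral_indicator_one (measurableSet_lt_passageTime a n)]
  refine lintegral_congr fun ξ => ?_
  by_cases h : (n : ℕ∞) < passageTime a ξ
  · rw [indicator_of_mem (by exact h), indicator_of_mem]
    · simp
    · rintro ⟨k, hk⟩
      exact (lt_passageTime_iff a n ξ).1 h k (Finset.mem_Iic.1 hk)
  · rw [indicator_of_notMem (by exact h), indicator_of_notMem]
    · simp
    · intro h'
      exact h ((lt_passageTime_iff a n ξ).2 fun k hk => h' ⟨k, Finset.mem_Iic.2 hk⟩)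

lemma survival_le_one (P : Kernel X X) [IsMarkovKernel P] (a : ℝ) (n : ℕ) (x : X) :
    survival P a n x ≤ 1 := by
  induction n generalizing x with
  | zero => rfl
  | succ n ih =>
    rw [survival_succ]
    calc _ ≤ ∫⁻ z, 1 ∂(P x) := (setLIntegral_le_lintegral _ _).trans (lintegral_mono ih)
      _ = 1 := by simp

lemma natCast_rpow_le_passageTime_rpow {a q : ℝ} (hq : 0 < q) {n : ℕ} {ξ : ℕ → X}
    (h : (n : ℕ∞) < passageTime a ξ) :
    ENNReal.ofReal ((n : ℝ) ^ q) ≤ (passageTime a ξ : ℝ≥0∞) ^ q := by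
  rw [← ENNReal.ofReal_rpow_of_nonneg n.cast_nonneg hq.le, ENNReal.ofReal_natCast]
  refine ENNReal.rpow_le_rpow ?_ hq.le
  have : ((n : ℕ∞) : ℝ≥0∞) ≤ (passageTime a ξ : ℝ≥0∞) := ENat.toENNReal_le.2 h.le
  simpa using this

/-- Were the moment finite, the integral of τ^q over {τ > n} would tend to 0 by absolute continuity;
yet it dominates n^q ℙ(τ > n) ≥ C. This argument includes the boundary q = p. -/
lemma passageMoment_eq_top (P : Kernel X X) [IsMarkovKernel P] {a p q C : ℝ} {x : X}
    (hx : a < (x : ℝ)) (hq : 0 < q) (hpq : p ≤ q) (hC : 0 < C)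
    (h : ∀ᶠ n : ℕ in atTop, ENNReal.ofReal (C * (n : ℝ) ^ (-p)) ≤ survival P a n x) :
    passageMoment P a q x = ⊤ := by
  by_contra hne
  unfold passageMoment at hne
  set s : ℕ → Set (ℕ → X) := fun n => {ξ | (n : ℕ∞) < passageTime a ξ} with hs
  have hle : ∀ n : ℕ, ENNReal.ofReal ((n : ℝ) ^ q) * pathLaw P x (s n) ≤
      ∫⁻ ξ in s n, (passageTime a ξ : ℝ≥0∞) ^ q ∂(pathLaw P x) := by
    intro n
    rw [← setLIntegral_const]
    exact setLIntegral_mono' (measurableSet_lt_passageTime a n)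
      fun ξ hξ => natCast_rpow_le_passageTime_rpow hq hξ
  have hpow : Tendsto (fun n : ℕ => ENNReal.ofReal ((n : ℝ) ^ q)) atTop (𝓝 ⊤) :=
    ENNReal.tendsto_ofReal_nhds_top.2
      ((tendsto_rpow_atTop hq).comp tendsto_natCast_atTop_atTop)
  have hμ : Tendsto (fun n => pathLaw P x (s n)) atTop (𝓝 0) := by
    have h1 : Tendsto (fun n : ℕ => (∫⁻ ξ, (passageTime a ξ : ℝ≥0∞) ^ q ∂(pathLaw P x)) /
        ENNReal.ofReal ((n : ℝ) ^ q)) atTop (𝓝 0) := by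
      have := ENNReal.Tendsto.const_div hpow
        (a := ∫⁻ ξ, (passageTime a ξ : ℝ≥0∞) ^ q ∂(pathLaw P x)) (Or.inr hne)
      simpa using this
    refine tendsto_of_tendsto_of_tendsto_of_le_of_le' tendsto_const_nhds h1
      (Eventually.of_forall fun _ => zero_le) ?_
    filter_upwards [eventually_ge_atTop 1] with n hn
    have hpos : (0 : ℝ) < (n : ℝ) ^ q := Real.rpow_pos_of_pos (by exact_mod_cast hn) _
    rw [ENNReal.le_div_iff_mul_le (Or.inl (by simpa using hpos)) (Or.inl ENNReal.ofReal_ne_top),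
      mul_comm]
    exact (hle n).trans (setLIntegral_le_lintegral _ _)
  have h0 := tendsto_setLIntegral_zero hne hμ
  have hlow : ∀ᶠ n : ℕ in atTop, ENNReal.ofReal C ≤
      ∫⁻ ξ in s n, (passageTime a ξ : ℝ≥0∞) ^ q ∂(pathLaw P x) := by
    filter_upwards [h, eventually_ge_atTop 1] with n hn hn1
    refine le_trans ?_ (hle n)
    rw [pathLaw_lt_passageTime P hx n]
    refine le_trans ?_ (mul_le_mul_right hn _)
    have hn1' : (1 : ℝ) ≤ n := by exact_mod_cast hn1
    rw [← ENNReal.ofReal_mul (by positivity)]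
    refine ENNReal.ofReal_le_ofReal ?_
    rw [mul_left_comm, ← Real.rpow_add (by positivity)]
    exact le_mul_of_one_le_right hC.le (Real.one_le_rpow hn1' (by linarith))
  have := le_of_tendsto_of_tendsto tendsto_const_nhds h0 hlow
  simp only [nonpos_iff_eq_zero, ENNReal.ofReal_eq_zero] at this
  linarith

lemma toENNReal_rpow_le_tsum (m : ℕ∞) {q : ℝ} (hq : 0 < q) :
    (m : ℝ≥0∞) ^ q ≤ 1 + ∑' k : ℕ, {j : ℕ∞ | ((2 ^ k : ℕ) : ℕ∞) < j}.indicator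
      (fun _ => ENNReal.ofReal ((2 : ℝ) ^ ((k + 1 : ℕ) * q))) m := by
  induction m using ENat.recTopCoe with
  | top =>
    refine le_trans le_top (le_trans (le_of_eq ?_) le_add_self)
    symm
    rw [← top_le_iff, ← ENNReal.tsum_const_eq_top_of_ne_zero (α := ℕ) one_ne_zero]
    refine ENNReal.tsum_le_tsum fun k => ?_
    rw [indicator_of_mem (by exact ENat.natCast_lt_top _), ← ENNReal.ofReal_one]
    exact ENNReal.ofReal_le_ofReal (Real.one_le_rpow (by norm_num) (by positivity))
  | coe m =>
    rcases le_or_gt m 1 with hm | hm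
    · refine le_trans ?_ le_self_add
      refine ENNReal.rpow_le_one ?_ hq.le
      simpa using hm
    -- Taking the logarithm of `m - 1` gives 2^k < m ≤ 2^(k+1), strict on the left as the indicator
    -- requires; this single term of the sum suffices.
    · set k := Nat.log 2 (m - 1) with hk
      have h1 : 2 ^ k < m := by
        have := Nat.pow_log_le_self 2 (x := m - 1) (by omega)
        rw [← hk] at this; omega
      have h2 : m ≤ 2 ^ (k + 1) := by
        have := Nat.lt_pow_succ_log_self (b := 2) (by norm_num) (m - 1)
        rw [← hk] at this; omega
      refine le_trans ?_ le_add_self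
      refine le_trans ?_ (ENNReal.le_tsum k)
      have h3 : ((2 ^ k : ℕ) : ℕ∞) < (m : ℕ∞) := Nat.cast_lt.2 h1
      rw [indicator_of_mem (mem_ofPred_eq ▸ h3), Real.rpow_natCast_mul (by norm_num),
        ← ENNReal.ofReal_rpow_of_nonneg (by positivity) hq.le]
      refine ENNReal.rpow_le_rpow ?_ hq.le
      rw [show ((m : ℕ∞) : ℝ≥0∞) = ENNReal.ofReal (m : ℝ) by simp]
      exact ENNReal.ofReal_le_ofReal (by exact_mod_cast h2)

/-- On 2^k < τ ≤ 2^(k+1) the q-th power is at most 2^((k+1)q), so the moment is dominated by a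
geometric series of ratio 2^(q-p) < 1. -/
lemma passageMoment_lt_top (P : Kernel X X) [IsMarkovKernel P] {a p q C : ℝ} {x : X}
    (hx : a < (x : ℝ)) (hq : 0 < q) (hpq : q < p)
    (h : ∀ n : ℕ, 1 ≤ n → survival P a n x ≤ ENNReal.ofReal (C * (n : ℝ) ^ (-p))) :
    passageMoment P a q x < ⊤ := by
  have hC : 0 ≤ C ∨ C < 0 := le_or_gt 0 C
  have hterm : ∀ k : ℕ, ENNReal.ofReal ((2 : ℝ) ^ ((k + 1 : ℕ) * q)) * survival P a (2 ^ k) x ≤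
      ENNReal.ofReal (|C| * 2 ^ q) * ENNReal.ofReal ((2 : ℝ) ^ (q - p)) ^ k := by
    intro k
    refine (mul_le_mul_right (h _ Nat.one_le_two_pow) _).trans ?_
    rw [← ENNReal.ofReal_mul (by positivity), ← ENNReal.ofReal_pow (by positivity),
      ← ENNReal.ofReal_mul (by positivity)]
    refine ENNReal.ofReal_le_ofReal ?_
    have e1 : ((2 ^ k : ℕ) : ℝ) ^ (-p) = 2 ^ ((k : ℝ) * (-p)) := by
      rw [Real.rpow_natCast_mul (by norm_num)]; norm_cast
    have e2 : ((2 : ℝ) ^ (q - p)) ^ k = 2 ^ ((k : ℝ) * (q - p)) := by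
      rw [mul_comm, Real.rpow_mul_natCast (by norm_num)]
    rw [e1, e2]
    calc (2 : ℝ) ^ ((k + 1 : ℕ) * q) * (C * 2 ^ ((k : ℝ) * (-p)))
        ≤ (2 : ℝ) ^ ((k + 1 : ℕ) * q) * (|C| * 2 ^ ((k : ℝ) * (-p))) := by
          gcongr; exact le_abs_self C
      _ = |C| * (2 ^ ((k + 1 : ℕ) * q) * 2 ^ ((k : ℝ) * (-p))) := by ring
      _ = |C| * (2 ^ q * 2 ^ ((k : ℝ) * (q - p))) := by
          rw [← Real.rpow_add (by norm_num), ← Real.rpow_add (by norm_num)]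
          congr 2; push_cast; ring
      _ = _ := by ring
  unfold passageMoment
  calc ∫⁻ ξ, (passageTime a ξ : ℝ≥0∞) ^ q ∂(pathLaw P x)
      ≤ ∫⁻ ξ, (1 + ∑' k : ℕ, {ξ : ℕ → X | ((2 ^ k : ℕ) : ℕ∞) < passageTime a ξ}.indicator
          (fun _ => ENNReal.ofReal ((2 : ℝ) ^ ((k + 1 : ℕ) * q))) ξ) ∂(pathLaw P x) :=
        lintegral_mono fun ξ => toENNReal_rpow_le_tsum (passageTime a ξ) hq
    _ = 1 + ∑' k : ℕ, ENNReal.ofReal ((2 : ℝ) ^ ((k + 1 : ℕ) * q)) * survival P a (2 ^ k) x := by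
        rw [lintegral_add_left measurable_const, lintegral_const, measure_univ, mul_one,
          lintegral_tsum fun k => (measurable_const.indicator
            (measurableSet_lt_passageTime a _)).aemeasurable]
        congr 1
        refine tsum_congr fun k => ?_
        rw [lintegral_indicator_const (measurableSet_lt_passageTime a _),
          pathLaw_lt_passageTime P hx]
    _ ≤ 1 + ∑' k : ℕ, ENNReal.ofReal (|C| * 2 ^ q) * ENNReal.ofReal ((2 : ℝ) ^ (q - p)) ^ k := by
        exact add_le_add le_rfl (ENNReal.tsum_le_tsum hterm)
    _ < ⊤ := by
        rw [ENNReal.tsum_mul_left, ENNReal.tsum_geometric]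
        refine ENNReal.add_lt_top.2 ⟨ENNReal.one_lt_top, ENNReal.mul_lt_top ENNReal.ofReal_lt_top ?_⟩
        rw [ENNReal.inv_lt_top, tsub_pos_iff_lt, ← ENNReal.ofReal_one]
        exact (ENNReal.ofReal_lt_ofReal_iff one_pos).2
          (Real.rpow_lt_one_of_one_lt_of_neg (by norm_num) (by linarith))

/-! ### Upper bounds on survival from Lyapunov functions -/

/-- A power Lyapunov function `x ^ ν` contracting at rate `ε x ^ (-δ)` bounds the survival
probability, with a free truncation level `R`. -/
lemma survival_le_of_lyapunov (P : Kernel X X) [IsMarkovKernel P] {a ν δ ε : ℝ}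
    (hν : 0 < ν) (hδ : 0 < δ) (hε : 0 < ε) (hε1 : ε ≤ 1) (ha : 1 ≤ a)
    (hstep : ∀ x : X, a < (x : ℝ) → ∫⁻ z : X, ENNReal.ofReal ((z : ℝ) ^ ν) ∂(P x) ≤
      ENNReal.ofReal ((1 - ε * (x : ℝ) ^ (-δ)) * (x : ℝ) ^ ν))
    {R : ℝ} (hR : 1 ≤ R) (n : ℕ) (x : X) (hx : a < (x : ℝ)) :
    survival P a n x ≤
      ENNReal.ofReal ((R ^ (-ν) + (1 - ε * R ^ (-δ)) ^ n) * (x : ℝ) ^ ν) := by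
  have hR0 : 0 < R := by linarith
  have hle1 : ∀ y : ℝ, 1 ≤ y → 0 ≤ 1 - ε * y ^ (-δ) := fun y hy => by
    have : y ^ (-δ) ≤ 1 := Real.rpow_le_one_of_one_le_of_nonpos hy (by linarith)
    have h0 : 0 ≤ y ^ (-δ) := Real.rpow_nonneg (by linarith) _
    nlinarith
  induction n generalizing x with
  | zero =>
    rw [survival_zero, pow_zero, ← ENNReal.ofReal_one]
    refine ENNReal.ofReal_le_ofReal ?_
    have h1 : 1 ≤ (x : ℝ) ^ ν := Real.one_le_rpow (by linarith) hν.le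
    have h2 : 0 ≤ R ^ (-ν) := by positivity
    nlinarith
  | succ n ih =>
    have hx0 : 0 < (x : ℝ) := by linarith
    have hρ := hle1 R hR
    -- Below R the contraction rate is at least ε R^(-δ): the term R^(-ν) x^ν does not grow, and the
    -- other gains a factor 1 - ε R^(-δ). Above R the term R^(-ν) x^ν already exceeds 1.
    rcases le_or_gt (x : ℝ) R with hxR | hxR
    · rw [survival_succ]
      calc killedStep P a (survival P a n) x
          ≤ killedStep P a (fun z => ENNReal.ofReal (R ^ (-ν) + (1 - ε * R ^ (-δ)) ^ n) *
              ENNReal.ofReal ((z : ℝ) ^ ν)) x :=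
            killedStep_mono P a (fun z hz => (ih z hz).trans_eq
              (ENNReal.ofReal_mul (by positivity))) x
        _ ≤ ∫⁻ z, ENNReal.ofReal (R ^ (-ν) + (1 - ε * R ^ (-δ)) ^ n) *
              ENNReal.ofReal ((z : ℝ) ^ ν) ∂(P x) := setLIntegral_le_lintegral _ _
        _ = ENNReal.ofReal (R ^ (-ν) + (1 - ε * R ^ (-δ)) ^ n) *
              ∫⁻ z : X, ENNReal.ofReal ((z : ℝ) ^ ν) ∂(P x) :=
            lintegral_const_mul _ (by fun_prop)
        _ ≤ ENNReal.ofReal (R ^ (-ν) + (1 - ε * R ^ (-δ)) ^ n) *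
              ENNReal.ofReal ((1 - ε * (x : ℝ) ^ (-δ)) * (x : ℝ) ^ ν) := by
            gcongr; exact hstep x hx
        _ ≤ _ := by
            rw [← ENNReal.ofReal_mul (by positivity)]
            refine ENNReal.ofReal_le_ofReal ?_
            rw [← mul_assoc]
            refine mul_le_mul_of_nonneg_right ?_ (by positivity)
            have h1 : R ^ (-δ) ≤ (x : ℝ) ^ (-δ) :=
              Real.rpow_le_rpow_of_nonpos hx0 hxR (by linarith)
            have h2 : 0 ≤ (x : ℝ) ^ (-δ) := by positivity
            have h3 : 0 ≤ R ^ (-ν) := by positivity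
            have h4 : 0 ≤ (1 - ε * R ^ (-δ)) ^ n := by positivity
            rw [pow_succ, add_mul]
            refine add_le_add ?_ (mul_le_mul_of_nonneg_left ?_ h4)
            · exact mul_le_of_le_one_right h3 (by nlinarith)
            · nlinarith
    · refine (survival_le_one P a _ x).trans ?_
      rw [← ENNReal.ofReal_one]
      refine ENNReal.ofReal_le_ofReal ?_
      have h1 : R ^ (-ν) * (x : ℝ) ^ ν ≥ 1 := by
        rw [Real.rpow_neg hR0.le, ← div_eq_inv_mul, ge_iff_le, one_le_div (by positivity)]
        exact Real.rpow_le_rpow hR0.le hxR.le hν.le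
      have h4 : 0 ≤ (1 - ε * R ^ (-δ)) ^ (n + 1) * (x : ℝ) ^ ν := by positivity
      rw [add_mul]; linarith

/-- From e^y ≥ y^k / k! with k ≥ p / η. -/
lemma exists_exp_neg_rpow_le {ε η p : ℝ} (hε : 0 < ε) (hη : 0 < η) :
    ∃ C : ℝ, ∀ n : ℕ, 1 ≤ n → Real.exp (-(ε * (n : ℝ) ^ η)) ≤ C * (n : ℝ) ^ (-p) := by
  obtain ⟨k, hk⟩ := exists_nat_ge (p / η)
  refine ⟨k.factorial * (ε ^ k)⁻¹, fun n hn => ?_⟩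
  have hn' : (1 : ℝ) ≤ n := by exact_mod_cast hn
  have hy : 0 < ε * (n : ℝ) ^ η := by positivity
  have h1 := Real.pow_div_factorial_le_exp (ε * (n : ℝ) ^ η) hy.le k
  rw [Real.exp_neg]
  have h2 : ((ε * (n : ℝ) ^ η) ^ k / k.factorial)⁻¹ ≤ k.factorial * (ε ^ k)⁻¹ * (n : ℝ) ^ (-p) := by
    rw [inv_div, mul_pow, ← Real.rpow_mul_natCast (by positivity), div_eq_mul_inv, mul_inv,
      ← Real.rpow_neg (by positivity), mul_assoc]
    gcongr ?_ * (?_ * ?_)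
    exact Real.rpow_le_rpow_of_exponent_le hn' (by rw [div_le_iff₀ hη] at hk; linarith)
  exact (inv_anti₀ (by positivity) h1).trans h2

/-- With q < p < ν/δ and truncation level R = n^(p/ν), the first term of the survival bound is
n^(-p), while the second is at most exp(-ε n^(1 - pδ/ν)), smaller than any power. -/
lemma passageMoment_lt_top_of_lyapunov (P : Kernel X X) [IsMarkovKernel P] {a ν δ ε q : ℝ}
    (hν : 0 < ν) (hδ : 0 < δ) (hε : 0 < ε) (hε1 : ε ≤ 1) (ha : 1 ≤ a)
    (hstep : ∀ x : X, a < (x : ℝ) → ∫⁻ z : X, ENNReal.ofReal ((z : ℝ) ^ ν) ∂(P x) ≤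
      ENNReal.ofReal ((1 - ε * (x : ℝ) ^ (-δ)) * (x : ℝ) ^ ν))
    (hq : 0 < q) (hqν : q < ν / δ) (x : X) (hx : a < (x : ℝ)) :
    passageMoment P a q x < ⊤ := by
  obtain ⟨p, hqp, hp⟩ := exists_between hqν
  have hη : 0 < 1 - p / ν * δ := by
    have : p * δ < ν := (lt_div_iff₀ hδ).1 hp
    rw [div_mul_eq_mul_div, sub_pos, div_lt_one hν]; exact this
  obtain ⟨C, hC⟩ := exists_exp_neg_rpow_le (p := p) hε hη
  refine passageMoment_lt_top P hx hq hqp (C := (1 + C) * (x : ℝ) ^ ν) fun n hn => ?_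
  have hn' : (1 : ℝ) ≤ n := by exact_mod_cast hn
  have hn0 : (0 : ℝ) < n := by linarith
  have hR : (1 : ℝ) ≤ (n : ℝ) ^ (p / ν) :=
    Real.one_le_rpow hn' (div_nonneg (by linarith) hν.le)
  refine (survival_le_of_lyapunov P hν hδ hε hε1 ha hstep hR n x hx).trans
    (ENNReal.ofReal_le_ofReal ?_)
  rw [← Real.rpow_mul hn0.le, ← Real.rpow_mul hn0.le,
    show p / ν * -ν = -p by field_simp, mul_right_comm]
  have hx0 : 0 < (x : ℝ) := by linarith
  refine mul_le_mul_of_nonneg_right ?_ (by positivity)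
  rw [add_mul, one_mul]
  refine add_le_add le_rfl (le_trans ?_ (hC n hn))
  have h1 : 1 - ε * (n : ℝ) ^ (p / ν * -δ) ≤ Real.exp (-(ε * (n : ℝ) ^ (p / ν * -δ))) := by
    have := Real.add_one_le_exp (-(ε * (n : ℝ) ^ (p / ν * -δ)))
    linarith
  have h0 : 0 ≤ 1 - ε * (n : ℝ) ^ (p / ν * -δ) := by
    have : (n : ℝ) ^ (p / ν * -δ) ≤ 1 := Real.rpow_le_one_of_one_le_of_nonpos hn' (by
      have : 0 < p / ν * δ := by have : 0 < p := hq.trans hqp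
                                 positivity
      linarith)
    have h0 : 0 ≤ (n : ℝ) ^ (p / ν * -δ) := by positivity
    nlinarith
  refine (pow_le_pow_left₀ h0 h1 n).trans_eq ?_
  rw [← Real.exp_nat_mul]
  congr 1
  have : (n : ℝ) ^ (1 - p / ν * δ) = n * (n : ℝ) ^ (p / ν * -δ) := by
    rw [show 1 - p / ν * δ = 1 + p / ν * -δ by ring, Real.rpow_add hn0, Real.rpow_one]
  rw [this]; ring

/-! ### Lower bounds on survival from test functions -/

lemma killedStep_const_mul (P : Kernel X X) (a : ℝ) {c : ℝ≥0∞} {g : X → ℝ≥0∞}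
    (hg : Measurable g) (x : X) :
    killedStep P a (fun z => c * g z) x = c * killedStep P a g x :=
  lintegral_const_mul c hg

/-- A bounded nonnegative function decaying at rate at most `ρ` per step bounds the survival
probability from below. -/
lemma le_survival_of_subinvariant (P : Kernel X X) [IsMarkovKernel P] {a M ρ : ℝ} (hM : 0 < M)
    (hρ : 0 ≤ ρ) {g : X → ℝ} (hg : Measurable g) (hgM : ∀ z, g z ≤ M)
    (hstep : ∀ y : X, a < (y : ℝ) → ENNReal.ofReal (ρ * g y) ≤
      killedStep P a (fun z => ENNReal.ofReal (g z)) y) (n : ℕ) (x : X) (hx : a < (x : ℝ)) :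
    ENNReal.ofReal (M⁻¹ * (ρ ^ n * g x)) ≤ survival P a n x := by
  induction n generalizing x with
  | zero =>
    rw [survival_zero, ← ENNReal.ofReal_one]
    refine ENNReal.ofReal_le_ofReal ?_
    rw [pow_zero, one_mul, ← div_eq_inv_mul, div_le_one hM]
    exact hgM x
  | succ n ih =>
    rw [survival_succ]
    refine le_trans ?_ (killedStep_mono P a ih x)
    have : (fun z => ENNReal.ofReal (M⁻¹ * (ρ ^ n * g z))) =
        fun z => ENNReal.ofReal (M⁻¹ * ρ ^ n) * ENNReal.ofReal (g z) := by
      ext z; rw [← ENNReal.ofReal_mul (by positivity), mul_assoc]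
    rw [this, killedStep_const_mul P a hg.ennreal_ofReal]
    refine le_trans ?_ (mul_le_mul_right (hstep x hx) _)
    rw [← ENNReal.ofReal_mul (by positivity)]
    refine ENNReal.ofReal_le_ofReal (le_of_eq ?_)
    ring

/-- A function bounded by `1` losing at most `κ` per step bounds the survival probability from
below. -/
lemma le_survival_of_additive (P : Kernel X X) [IsMarkovKernel P] {a κ : ℝ}
    {g : X → ℝ} (hg1 : ∀ z, g z ≤ 1)
    (hstep : ∀ y : X, a < (y : ℝ) → ENNReal.ofReal (g y) ≤
      killedStep P a (fun z => ENNReal.ofReal (g z)) y + ENNReal.ofReal κ)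
    (n : ℕ) (x : X) (hx : a < (x : ℝ)) :
    ENNReal.ofReal (g x) ≤ survival P a n x + n * ENNReal.ofReal κ := by
  induction n generalizing x with
  | zero =>
    rw [survival_zero, ← ENNReal.ofReal_one]
    exact (ENNReal.ofReal_le_ofReal (hg1 x)).trans le_self_add
  | succ n ih =>
    rw [survival_succ]
    calc ENNReal.ofReal (g x) ≤ _ := hstep x hx
      _ ≤ killedStep P a (fun z => survival P a n z + n * ENNReal.ofReal κ) x +
          ENNReal.ofReal κ := by gcongr; exact killedStep_mono P a ih x
      _ ≤ (killedStep P a (survival P a n) x + n * ENNReal.ofReal κ) + ENNReal.ofReal κ := by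
          gcongr
          unfold killedStep
          rw [lintegral_add_left (measurable_survival P a n), setLIntegral_const]
          exact add_le_add le_rfl (mul_le_of_le_one_right zero_le prob_le_one)
      _ = _ := by push_cast; ring

/-! ### The stable drift integral and its Gamma form -/

/-- Bernoulli's inequality for the exponent -p in [0, 1], inverted by means of (1 + ps)(1 - ps) ≤ 1.
-/
lemma one_add_mul_le_rpow_of_neg {s p : ℝ} (hs0 : 0 < 1 + s) (hp : -1 ≤ p)
    (hp0 : p ≤ 0) : 1 + p * s ≤ (1 + s) ^ p := by
  have h := rpow_one_add_le_one_add_mul_self (s := s) (by linarith) (p := -p) (by linarith)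
    (by linarith)
  have hpos : 0 < (1 + s) ^ (-p) := Real.rpow_pos_of_pos hs0 _
  have h1 : (1 + s) ^ p = ((1 + s) ^ (-p))⁻¹ := by rw [← Real.rpow_neg hs0.le, neg_neg]
  rw [h1, ← one_div, le_div_iff₀ hpos]
  rcases le_or_gt (1 + p * s) 0 with h2 | h2
  · nlinarith
  · nlinarith [sq_nonneg (p * s)]

lemma abs_rpow_one_add_sub_one_le {s u : ℝ} (hs : -1 < s) (hs1 : s < 1) (hu : 0 < u) :
    |(1 + u) ^ s - 1| ≤ u := by
  rcases le_or_gt 0 s with h | h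
  · have h1 := rpow_one_add_le_one_add_mul_self (s := u) (by linarith) h hs1.le
    have h2 := Real.one_le_rpow (x := 1 + u) (by linarith) h
    rw [abs_of_nonneg (by linarith)]; nlinarith
  · have h1 := one_add_mul_le_rpow_of_neg (s := u) (by linarith) hs.le h.le
    have h2 := Real.rpow_le_one_of_one_le_of_nonpos (x := 1 + u) (by linarith) h.le
    rw [abs_of_nonpos (by linarith)]; nlinarith

lemma abs_rpow_one_add_sub_one_le_rpow {s u : ℝ} (hs1 : s < 1) (hu : 1 < u) :
    |(1 + u) ^ s - 1| ≤ 2 * u ^ (max s 0) := by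
  rcases le_or_gt 0 s with h | h
  · have h2 := Real.one_le_rpow (x := 1 + u) (by linarith) h
    rw [abs_of_nonneg (by linarith), max_eq_left h]
    calc (1 + u) ^ s - 1 ≤ (1 + u) ^ s := by linarith
      _ ≤ (2 * u) ^ s := Real.rpow_le_rpow (by linarith) (by linarith) h
      _ = 2 ^ s * u ^ s := Real.mul_rpow (by norm_num) (by linarith)
      _ ≤ 2 * u ^ s := by
        gcongr
        calc (2 : ℝ) ^ s ≤ 2 ^ (1 : ℝ) := Real.rpow_le_rpow_of_exponent_le (by norm_num) hs1.le
          _ = 2 := Real.rpow_one 2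
  · have h2 := Real.rpow_le_one_of_one_le_of_nonpos (x := 1 + u) (by linarith) h.le
    have h3 : 0 < (1 + u) ^ s := Real.rpow_pos_of_pos (by linarith) _
    rw [abs_of_nonpos (by linarith), max_eq_right h.le, Real.rpow_zero]
    linarith

/-- The integral `∫₀^∞ ((1 + u) ^ (ν - 1) - 1) u ^ (-α) du`, the normalized drift of `x ^ ν` under
a totally asymmetric `α`-stable jump kernel. -/
noncomputable def stableDrift (α ν : ℝ) : ℝ :=
  ∫ u in Ioi (0 : ℝ), ((1 + u) ^ (ν - 1) - 1) * u ^ (-α)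

/-- The bracket is O(u) near 0, where α < 2 suffices, and O(u^max(ν-1, 0)) at infinity, where α >
max(ν, 1) suffices. -/
lemma integrableOn_rpow_one_add_sub_one_mul {α ν : ℝ} (hα : 1 < α) (hα2 : α < 2) (hν : 0 < ν)
    (hνα : ν < α) :
    IntegrableOn (fun u : ℝ => ((1 + u) ^ (ν - 1) - 1) * u ^ (-α)) (Ioi 0) := by
  have hcont : ContinuousOn (fun u : ℝ => ((1 + u) ^ (ν - 1) - 1) * u ^ (-α)) (Ioi 0) := by
    intro u hu
    have hu : (0 : ℝ) < u := hu
    refine ContinuousAt.continuousWithinAt ?_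
    refine ((ContinuousAt.rpow_const (by fun_prop) (Or.inl (by linarith))).sub
      continuousAt_const).mul (ContinuousAt.rpow_const (by fun_prop) (Or.inl hu.ne'))
  rw [← Ioc_union_Ioi_eq_Ioi (zero_le_one' ℝ)]
  refine IntegrableOn.union ?_ ?_
  · have hi : IntegrableOn (fun u : ℝ => u ^ (1 - α)) (Ioc 0 1) := by
      rw [← intervalIntegrable_iff_integrableOn_Ioc_of_le zero_le_one]
      exact intervalIntegral.intervalIntegrable_rpow' (by linarith)
    refine Integrable.mono' hi ((hcont.mono Ioc_subset_Ioi_self).aestronglyMeasurable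
      measurableSet_Ioc) ?_
    refine (ae_restrict_iff' measurableSet_Ioc).2 (Eventually.of_forall fun u hu => ?_)
    have hu0 : 0 < u := hu.1
    rw [norm_mul, Real.norm_eq_abs, Real.norm_of_nonneg (by positivity),
      show 1 - α = 1 + -α by ring, Real.rpow_add hu0, Real.rpow_one]
    gcongr
    exact abs_rpow_one_add_sub_one_le (by linarith) (by linarith) hu0
  · have hi : IntegrableOn (fun u : ℝ => 2 * u ^ (max (ν - 1) 0 - α)) (Ioi 1) :=
      (integrableOn_Ioi_rpow_of_lt (by rcases max_cases (ν - 1) 0 with h | h <;> linarith)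
        one_pos).const_mul 2
    refine Integrable.mono' hi ((hcont.mono (Ioi_subset_Ioi zero_le_one)).aestronglyMeasurable
      measurableSet_Ioi) ?_
    refine (ae_restrict_iff' measurableSet_Ioi).2 (Eventually.of_forall fun u hu => ?_)
    have hu1 : 1 < u := hu
    have hu0 : 0 < u := by linarith
    rw [norm_mul, Real.norm_eq_abs, Real.norm_of_nonneg (by positivity), sub_eq_add_neg _ α,
      Real.rpow_add hu0, ← mul_assoc]
    gcongr
    exact abs_rpow_one_add_sub_one_le_rpow (by linarith) hu1

/-- The integrand is strictly increasing in ν at each u > 0. This gives uniqueness of the root and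
the strict sign of the drift on either side of it. -/
lemma stableDrift_strictMono {α ν₁ ν₂ : ℝ} (hα : 1 < α) (hα2 : α < 2) (hν : 0 < ν₁)
    (h12 : ν₁ < ν₂) (hνα : ν₂ < α) : stableDrift α ν₁ < stableDrift α ν₂ := by
  have h1 := integrableOn_rpow_one_add_sub_one_mul hα hα2 hν (h12.trans hνα)
  have h2 := integrableOn_rpow_one_add_sub_one_mul hα hα2 (hν.trans h12) hνα
  have hpt : ∀ u ∈ Ioi (0 : ℝ), 0 < ((1 + u) ^ (ν₂ - 1) - 1) * u ^ (-α) -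
      ((1 + u) ^ (ν₁ - 1) - 1) * u ^ (-α) := by
    intro u hu
    have hu : (0 : ℝ) < u := hu
    rw [← sub_mul]
    refine mul_pos ?_ (by positivity)
    have := Real.rpow_lt_rpow_of_exponent_lt (x := 1 + u) (by linarith)
      (show ν₁ - 1 < ν₂ - 1 by linarith)
    linarith
  rw [← sub_pos]
  unfold stableDrift
  rw [← integral_sub h2 h1, setIntegral_pos_iff_support_of_nonneg_ae
    ((ae_restrict_iff' measurableSet_Ioi).2 (Eventually.of_forall fun u hu => (hpt u hu).le))
    (h2.sub h1)]
  rw [inter_eq_right.2 (fun u hu => Function.mem_support.2 (hpt u hu).ne')]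
  simp

lemma lintegral_rpow_mul_exp_neg_mul {s r : ℝ} (hs : 0 < s) (hr : 0 < r) :
    ∫⁻ t in Ioi (0 : ℝ), ENNReal.ofReal (t ^ (s - 1) * Real.exp (-(r * t))) =
      ENNReal.ofReal ((1 / r) ^ s * Real.Gamma s) := by
  have h := Real.integral_rpow_mul_exp_neg_mul_Ioi hs hr
  rw [← h, ofReal_integral_eq_lintegral_ofReal]
  -- A non-integrable function has Bochner integral 0, whereas the value here is positive;
  -- integrability follows.
  · by_contra hcon
    have := integral_undef hcon
    rw [h] at this
    have := Real.Gamma_pos_of_pos hs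
    have : 0 < (1 / r) ^ s * Real.Gamma s := by positivity
    linarith
  · refine (ae_restrict_iff' measurableSet_Ioi).2 (Eventually.of_forall fun u hu => ?_)
    have hu : (0 : ℝ) < u := hu
    positivity

/-- The Beta integral of the second kind. -/
lemma lintegral_rpow_mul_rpow_one_add {p m : ℝ} (hp : 0 < p) (hpm : p < m) :
    ∫⁻ u in Ioi (0 : ℝ), ENNReal.ofReal ((1 + u) ^ (-m) * u ^ (p - 1)) =
      ENNReal.ofReal (Real.Gamma p * Real.Gamma (m - p) / Real.Gamma m) := by
  have hm : 0 < m := hp.trans hpm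
  have hG := Real.Gamma_pos_of_pos hm
  have hmeas : Measurable (Function.uncurry fun u t : ℝ => ENNReal.ofReal (u ^ (p - 1) *
      (t ^ (m - 1) * Real.exp (-((1 + u) * t))))) := by
    unfold Function.uncurry; fun_prop
  -- Write Γ(m) (1 + u)^(-m) as the integral of t^(m-1) e^(-(1+u)t) and apply Tonelli: integrating
  -- in u gives Γ(p) t^(-p), then integrating in t gives Γ(m - p).
  have e1 : ∀ u ∈ Ioi (0 : ℝ), ENNReal.ofReal (Real.Gamma m) *
      ENNReal.ofReal ((1 + u) ^ (-m) * u ^ (p - 1)) =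
      ∫⁻ t in Ioi (0 : ℝ), ENNReal.ofReal (u ^ (p - 1) *
        (t ^ (m - 1) * Real.exp (-((1 + u) * t)))) := by
    intro u hu
    have hu : (0 : ℝ) < u := hu
    simp_rw [ENNReal.ofReal_mul (show 0 ≤ u ^ (p - 1) by positivity)]
    rw [lintegral_const_mul _ (by fun_prop),
      lintegral_rpow_mul_exp_neg_mul hm (by linarith),
      ← ENNReal.ofReal_mul hG.le, ← ENNReal.ofReal_mul (by positivity), one_div,
      Real.inv_rpow (by linarith), Real.rpow_neg (by linarith)]
    ring_nf
  have e2 : ∀ t ∈ Ioi (0 : ℝ), ∫⁻ u in Ioi (0 : ℝ), ENNReal.ofReal (u ^ (p - 1) *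
        (t ^ (m - 1) * Real.exp (-((1 + u) * t)))) =
      ENNReal.ofReal (Real.Gamma p) *
        ENNReal.ofReal (t ^ (m - p - 1) * Real.exp (-(1 * t))) := by
    intro t ht
    have ht : (0 : ℝ) < t := ht
    have : ∀ u : ℝ, u ^ (p - 1) * (t ^ (m - 1) * Real.exp (-((1 + u) * t))) =
        (t ^ (m - 1) * Real.exp (-(1 * t))) * (u ^ (p - 1) * Real.exp (-(t * u))) := by
      intro u
      rw [show -((1 + u) * t) = -(1 * t) + -(t * u) by ring, Real.exp_add]; ring
    simp_rw [this, ENNReal.ofReal_mul (show 0 ≤ t ^ (m - 1) * Real.exp (-(1 * t)) by positivity)]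
    rw [lintegral_const_mul _ (by fun_prop), lintegral_rpow_mul_exp_neg_mul hp ht,
      ← ENNReal.ofReal_mul (by positivity), ← ENNReal.ofReal_mul (Real.Gamma_pos_of_pos hp).le,
      one_div, Real.inv_rpow ht.le, ← Real.rpow_neg ht.le,
      show m - p - 1 = m - 1 + -p by ring, Real.rpow_add ht]
    ring_nf
  have key : ENNReal.ofReal (Real.Gamma m) *
      ∫⁻ u in Ioi (0 : ℝ), ENNReal.ofReal ((1 + u) ^ (-m) * u ^ (p - 1)) =
      ENNReal.ofReal (Real.Gamma p) * ENNReal.ofReal (Real.Gamma (m - p)) := by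
    rw [← lintegral_const_mul _ (by fun_prop), setLIntegral_congr_fun measurableSet_Ioi e1,
      lintegral_lintegral_swap hmeas.aemeasurable, setLIntegral_congr_fun measurableSet_Ioi e2,
      lintegral_const_mul _ (by fun_prop),
      lintegral_rpow_mul_exp_neg_mul (by linarith) one_pos]
    simp
  rw [ENNReal.ofReal_div_of_pos hG, ENNReal.ofReal_mul (Real.Gamma_pos_of_pos hp).le, ← key,
    mul_comm, ENNReal.mul_div_cancel_right (by simpa using hG) ENNReal.ofReal_ne_top]

lemma integrableOn_rpow_mul_rpow_one_add {p m : ℝ} (hp : 0 < p) (hpm : p < m) :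
    IntegrableOn (fun u : ℝ => (1 + u) ^ (-m) * u ^ (p - 1)) (Ioi 0) := by
  refine ⟨by fun_prop, ?_⟩
  rw [hasFiniteIntegral_iff_ofReal, lintegral_rpow_mul_rpow_one_add hp hpm]
  · exact ENNReal.ofReal_lt_top
  · refine (ae_restrict_iff' measurableSet_Ioi).2 (Eventually.of_forall fun u hu => ?_)
    have hu : (0 : ℝ) < u := hu
    positivity

lemma integral_rpow_mul_rpow_one_add {p m : ℝ} (hp : 0 < p) (hpm : p < m) :
    ∫ u in Ioi (0 : ℝ), (1 + u) ^ (-m) * u ^ (p - 1) =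
      Real.Gamma p * Real.Gamma (m - p) / Real.Gamma m := by
  rw [integral_eq_lintegral_of_nonneg_ae, lintegral_rpow_mul_rpow_one_add hp hpm,
    ENNReal.toReal_ofReal]
  · have := Real.Gamma_pos_of_pos hp
    have := Real.Gamma_pos_of_pos (sub_pos.2 hpm)
    have := Real.Gamma_pos_of_pos (hp.trans hpm)
    positivity
  · refine (ae_restrict_iff' measurableSet_Ioi).2 (Eventually.of_forall fun u hu => ?_)
    have hu : (0 : ℝ) < u := hu
    positivity
  · fun_prop

/-- Integration by parts against u^(1-α)/(1-α) leaves a Beta integral with p = 2 - α and m = 2 - ν;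
Γ(2 - α) = (1 - α) Γ(1 - α) cancels the denominator. Boundary terms vanish at 0 because α < 2 and at
infinity because α > max(ν, 1). -/
lemma stableDrift_eq_Gamma {α ν : ℝ} (hα : 1 < α) (hα2 : α < 2) (hν : 0 < ν) (hνα : ν < α) :
    stableDrift α ν =
      -((ν - 1) * (Real.Gamma (1 - α) * Real.Gamma (α - ν) / Real.Gamma (2 - ν))) := by
  have hderiv1 : ∀ u ∈ Ioi (0 : ℝ), HasDerivAt (fun u : ℝ => (1 + u) ^ (ν - 1) - 1)
      ((ν - 1) * (1 + u) ^ (-(2 - ν))) u := by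
    intro u hu
    have hu : (0 : ℝ) < u := hu
    have h := ((hasDerivAt_id u).const_add 1).rpow_const (p := ν - 1) (Or.inl (by simp; linarith))
    have h' := h.sub_const 1
    refine h'.congr_deriv ?_
    rw [show -(2 - ν) = ν - 1 - 1 by ring, id]; ring
  have hderiv2 : ∀ u ∈ Ioi (0 : ℝ), HasDerivAt (fun u : ℝ => (1 - α)⁻¹ * u ^ (1 - α))
      (u ^ (-α)) u := by
    intro u hu
    have hu : (0 : ℝ) < u := hu
    have h := (Real.hasDerivAt_rpow_const (p := 1 - α) (Or.inl hu.ne')).const_mul (1 - α)⁻¹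
    refine h.congr_deriv ?_
    have : (1 - α) ≠ 0 := by linarith
    rw [← mul_assoc, inv_mul_cancel₀ this, one_mul]; congr 1; ring
  have hB := integrableOn_rpow_mul_rpow_one_add (p := 2 - α) (m := 2 - ν) (by linarith)
    (by linarith)
  have hB' := integral_rpow_mul_rpow_one_add (p := 2 - α) (m := 2 - ν) (by linarith)
    (by linarith)
  have e : ∀ u : ℝ, (ν - 1) * (1 + u) ^ (-(2 - ν)) * ((1 - α)⁻¹ * u ^ (1 - α)) =
      ((ν - 1) * (1 - α)⁻¹) * ((1 + u) ^ (-(2 - ν)) * u ^ (2 - α - 1)) := by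
    intro u; rw [show 2 - α - 1 = 1 - α by ring]; ring
  have hlim0 : Tendsto ((fun u : ℝ => (1 + u) ^ (ν - 1) - 1) *
      fun u : ℝ => (1 - α)⁻¹ * u ^ (1 - α)) (𝓝[>] 0) (𝓝 0) := by
    have hb : Tendsto (fun u : ℝ => |(1 - α)⁻¹| * u ^ (2 - α)) (𝓝[>] 0) (𝓝 0) := by
      have h1 : Tendsto (fun u : ℝ => |(1 - α)⁻¹| * u ^ (2 - α)) (𝓝 0)
          (𝓝 (|(1 - α)⁻¹| * (0 : ℝ) ^ (2 - α))) :=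
        ((Real.continuousAt_rpow_const 0 (2 - α) (Or.inr (by linarith))).tendsto).const_mul _
      rw [Real.zero_rpow (by linarith), mul_zero] at h1
      exact h1.mono_left nhdsWithin_le_nhds
    refine squeeze_zero_norm' ?_ hb
    filter_upwards [self_mem_nhdsWithin] with u hu
    have hu : (0 : ℝ) < u := hu
    simp only [Pi.mul_apply, norm_mul, Real.norm_eq_abs]
    rw [show 2 - α = 1 + (1 - α) by ring, Real.rpow_add hu, Real.rpow_one,
      abs_of_nonneg (show 0 ≤ u ^ (1 - α) by positivity), mul_left_comm]
    gcongr
    exact abs_rpow_one_add_sub_one_le (by linarith) (by linarith) hu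
  have hliminf : Tendsto ((fun u : ℝ => (1 + u) ^ (ν - 1) - 1) *
      fun u : ℝ => (1 - α)⁻¹ * u ^ (1 - α)) atTop (𝓝 0) := by
    have hb : Tendsto (fun u : ℝ => (2 * |(1 - α)⁻¹|) * u ^ (-(α - 1 - max (ν - 1) 0))) atTop
        (𝓝 0) := by
      have h1 := (tendsto_rpow_neg_atTop (y := α - 1 - max (ν - 1) 0)
        (by rcases max_cases (ν - 1) 0 with h | h <;> linarith)).const_mul (2 * |(1 - α)⁻¹|)
      rwa [mul_zero] at h1
    refine squeeze_zero_norm' ?_ hb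
    filter_upwards [eventually_gt_atTop 1] with u hu
    have hu0 : (0 : ℝ) < u := by linarith
    simp only [Pi.mul_apply, norm_mul, Real.norm_eq_abs]
    rw [show -(α - 1 - max (ν - 1) 0) = max (ν - 1) 0 + (1 - α) by ring, Real.rpow_add hu0,
      abs_of_nonneg (show 0 ≤ u ^ (1 - α) by positivity)]
    calc _ ≤ (2 * u ^ max (ν - 1) 0) * (|(1 - α)⁻¹| * u ^ (1 - α)) := by
          gcongr
          exact abs_rpow_one_add_sub_one_le_rpow (by linarith) hu
      _ = _ := by ring
  have h := integral_Ioi_mul_deriv_eq_deriv_mul hderiv1 hderiv2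
    (integrableOn_rpow_one_add_sub_one_mul hα hα2 hν hνα)
    (by
      have : ((fun u : ℝ => (ν - 1) * (1 + u) ^ (-(2 - ν))) * fun u : ℝ =>
          (1 - α)⁻¹ * u ^ (1 - α)) = fun u => ((ν - 1) * (1 - α)⁻¹) *
            ((1 + u) ^ (-(2 - ν)) * u ^ (2 - α - 1)) := by
        ext u; simpa using e u
      rw [this]
      exact hB.const_mul _) hlim0 hliminf
  unfold stableDrift
  rw [h]
  simp_rw [e]
  rw [integral_const_mul, hB', show 2 - ν - (2 - α) = α - ν by ring,
    show 2 - α = (1 - α) + 1 by ring, Real.Gamma_add_one (by linarith)]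
  have : (1 - α) ≠ 0 := by linarith
  field_simp
  ring

/-! ### Existence and uniqueness of the critical root -/

lemma Gamma_continuousAt_of_pos {s : ℝ} (hs : 0 < s) : ContinuousAt Real.Gamma s :=
  (Real.differentiableAt_Gamma fun m => by
    have : (0 : ℝ) ≤ m := m.cast_nonneg
    linarith).continuousAt

/-- In this form the root makes the coefficient b + c I(ν) of the drift vanish, and monotonicity of
I applies. -/
lemma isCriticalRoot_iff {α b c ν : ℝ} (hα : 1 < α) (hα2 : α < 2) :
    IsCriticalRoot α b c ν ↔ 0 < ν ∧ ν < α ∧ b / c = -stableDrift α ν := by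
  unfold IsCriticalRoot
  refine and_congr_right fun h0 => and_congr_right fun h1 => ?_
  rw [stableDrift_eq_Gamma hα hα2 h0 h1, neg_neg]

lemma IsCriticalRoot.unique {α b c ν ν' : ℝ} (hα : 1 < α) (hα2 : α < 2)
    (h : IsCriticalRoot α b c ν) (h' : IsCriticalRoot α b c ν') : ν' = ν := by
  rw [isCriticalRoot_iff hα hα2] at h h'
  have heq : stableDrift α ν' = stableDrift α ν := by linarith [h.2.2, h'.2.2]
  rcases lt_trichotomy ν' ν with hlt | rfl | hlt
  · have := stableDrift_strictMono hα hα2 h'.1 hlt h.2.1; linarith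
  · rfl
  · have := stableDrift_strictMono hα hα2 h.1 hlt h'.2.1; linarith

/-- Intermediate value theorem on (0, α): the hypothesis on b says exactly that b/c lies below the
value at 0, and the right-hand side tends to -∞ at α. -/
lemma exists_isCriticalRoot {α b c : ℝ} (hα : 1 < α) (hα2 : α < 2) (hc : 0 < c)
    (hb : b < c * Real.pi * |(Real.sin (Real.pi * α))⁻¹|) : ∃ ν, IsCriticalRoot α b c ν := by
  set r : ℝ → ℝ := fun ν => (ν - 1) * (Real.Gamma (1 - α) * Real.Gamma (α - ν) /
    Real.Gamma (2 - ν)) with hr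
  have hcont : ∀ ν, ν < α → ContinuousAt r ν := by
    intro ν hν
    have h1 : ContinuousAt (fun ν => Real.Gamma (α - ν)) ν :=
      ContinuousAt.comp (f := fun ν => α - ν) (Gamma_continuousAt_of_pos (by linarith))
        (by fun_prop)
    have h2 : ContinuousAt (fun ν => Real.Gamma (2 - ν)) ν :=
      ContinuousAt.comp (f := fun ν => 2 - ν) (Gamma_continuousAt_of_pos (by linarith))
        (by fun_prop)
    have h3 : Real.Gamma (2 - ν) ≠ 0 := (Real.Gamma_pos_of_pos (by linarith)).ne'
    exact (by fun_prop : ContinuousAt (fun ν : ℝ => ν - 1) ν).mul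
      ((continuousAt_const.mul h1).div h2 h3)
  have hsin : Real.sin (Real.pi * α) < 0 := by
    have h1 := Real.sin_sub_pi (Real.pi * α)
    have h2 : 0 < Real.sin (Real.pi * α - Real.pi) :=
      Real.sin_pos_of_pos_of_lt_pi (by nlinarith [Real.pi_pos]) (by nlinarith [Real.pi_pos])
    linarith
  -- Euler's reflection formula evaluates r 0 = -π / sin(πα), which is positive since 1 < α < 2.
  have hr0 : b / c < r 0 := by
    have h1 := Real.Gamma_mul_Gamma_one_sub α
    have h2 : r 0 = Real.pi * |(Real.sin (Real.pi * α))⁻¹| := by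
      simp only [hr, sub_zero, zero_sub]
      rw [show Real.Gamma 2 = 1 by simp, mul_comm (Real.Gamma (1 - α)), h1,
        abs_of_neg (inv_neg''.2 hsin)]
      ring
    rw [h2, div_lt_iff₀ hc]; linarith
  -- The pole of Γ at 0 is extracted by Γ(α - ν) = Γ(α - ν + 1) / (α - ν); the remaining factor
  -- tends to (α - 1) Γ(1 - α) / Γ(2 - α) = -1.
  have hlim : Tendsto r (𝓝[<] α) atBot := by
    have hprod : Tendsto (fun ν => (ν - 1) * (Real.Gamma (1 - α) * Real.Gamma (α - ν + 1) /
        Real.Gamma (2 - ν))) (𝓝[<] α) (𝓝 (-1)) := by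
      have h1 : ContinuousAt (fun ν => (ν - 1) * (Real.Gamma (1 - α) * Real.Gamma (α - ν + 1) /
          Real.Gamma (2 - ν))) α := by
        have h1 : ContinuousAt (fun ν => Real.Gamma (α - ν + 1)) α :=
          ContinuousAt.comp (f := fun ν => α - ν + 1) (Gamma_continuousAt_of_pos (by linarith))
            (by fun_prop)
        have h2 : ContinuousAt (fun ν => Real.Gamma (2 - ν)) α :=
          ContinuousAt.comp (f := fun ν => 2 - ν) (Gamma_continuousAt_of_pos (by linarith))
            (by fun_prop)
        have h3 : Real.Gamma (2 - α) ≠ 0 := (Real.Gamma_pos_of_pos (by linarith)).ne'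
        exact (by fun_prop : ContinuousAt (fun ν : ℝ => ν - 1) α).mul
          ((continuousAt_const.mul h1).div h2 h3)
      have h2 : (α - 1) * (Real.Gamma (1 - α) * Real.Gamma (α - α + 1) / Real.Gamma (2 - α)) =
          -1 := by
        have hG : Real.Gamma (2 - α) = (1 - α) * Real.Gamma (1 - α) := by
          rw [show 2 - α = (1 - α) + 1 by ring, Real.Gamma_add_one (by linarith)]
        have h3 : Real.Gamma (2 - α) ≠ 0 := (Real.Gamma_pos_of_pos (by linarith)).ne'
        rw [sub_self, zero_add, Real.Gamma_one, mul_one, ← mul_div_assoc, div_eq_iff h3, hG]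
        ring
      have h3 := h1.tendsto.mono_left (nhdsWithin_le_nhds (s := Iio α))
      rwa [h2] at h3
    have hinv : Tendsto (fun ν => (α - ν)⁻¹) (𝓝[<] α) atTop := by
      refine tendsto_inv_nhdsGT_zero.comp (tendsto_nhdsWithin_iff.2 ⟨?_, ?_⟩)
      · have : ContinuousAt (fun ν => α - ν) α := by fun_prop
        have h := this.tendsto.mono_left (nhdsWithin_le_nhds (s := Iio α))
        rwa [sub_self] at h
      · filter_upwards [self_mem_nhdsWithin] with ν hν
        exact sub_pos.2 (mem_Iio.1 hν)
    refine (hinv.atTop_mul_neg (by norm_num : (-1 : ℝ) < 0) hprod).congr' ?_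
    filter_upwards [self_mem_nhdsWithin] with ν hν
    have hν : ν < α := hν
    have h0 : α - ν ≠ 0 := by linarith
    rw [Real.Gamma_add_one h0]
    simp only [hr]
    field_simp
  obtain ⟨ν₁, hν₁, hν₁α⟩ : ∃ ν₁, r ν₁ < b / c ∧ ν₁ ∈ Ioo 0 α :=
    ((hlim.eventually (eventually_lt_atBot (b / c))).and
      (Ioo_mem_nhdsLT (by linarith : (0 : ℝ) < α))).exists
  have hivt := intermediate_value_Ioo' hν₁α.1.le (f := r)
    (fun ν hν => (hcont ν (hν.2.trans_lt hν₁α.2)).continuousWithinAt)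
  obtain ⟨ν, hν, hνeq⟩ := hivt ⟨hν₁, hr0⟩
  exact ⟨ν, hν.1, hν.2.trans hν₁α.2, hνeq.symm⟩

/-! ### Uniform moment bounds for the increments -/

/-- Quadratic near the origin and of order `u ^ κ` at infinity. -/
noncomputable def cutPow (κ u : ℝ) : ℝ := min (u ^ (2 : ℝ)) (u ^ κ)

lemma cutPow_nonneg {κ u : ℝ} (hu : 0 ≤ u) : 0 ≤ cutPow κ u :=
  le_min (by positivity) (by positivity)

@[fun_prop]
lemma measurable_cutPow (κ : ℝ) : Measurable (cutPow κ) := by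
  unfold cutPow; fun_prop

lemma cutPow_le_rpow {κ p u : ℝ} (hκp : κ ≤ p) (hp : p ≤ 2) (hu : 0 ≤ u) (hp0 : 0 < p) :
    cutPow κ u ≤ u ^ p := by
  rcases hu.eq_or_lt with rfl | hu
  · rw [Real.zero_rpow hp0.ne']
    exact (min_le_left _ _).trans (by norm_num)
  · rcases le_or_gt u 1 with h | h
    · exact (min_le_left _ _).trans (Real.rpow_le_rpow_of_exponent_ge hu h hp)
    · exact (min_le_right _ _).trans (Real.rpow_le_rpow_of_exponent_le h.le hκp)

lemma continuousOn_min_rpow {κ : ℝ} (hκ : 1 ≤ κ) (s : Set ℝ) :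
    ContinuousOn (fun t : ℝ => 2 * min t (t ^ (κ - 1))) s := by
  have : Continuous fun t : ℝ => t ^ (κ - 1) := Real.continuous_rpow_const (by linarith)
  exact (by fun_prop : Continuous fun t : ℝ => 2 * min t (t ^ (κ - 1))).continuousOn

/-- The layer-cake formula needs a primitive of a nonnegative density. The one chosen dominates the
derivative of `cutPow`, which is 2t below 1 and κ t^(κ-1) ≤ 2 t^(κ-1) above. -/
lemma cutPow_le_integral {κ u : ℝ} (hκ : 1 ≤ κ) (hκ2 : κ ≤ 2) (hu : 0 ≤ u) :
    cutPow κ u ≤ ∫ t in (0 : ℝ)..u, 2 * min t (t ^ (κ - 1)) := by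
  have hII : ∀ p q : ℝ, IntervalIntegrable (fun t : ℝ => 2 * min t (t ^ (κ - 1))) volume p q :=
    fun p q => (continuousOn_min_rpow hκ _).intervalIntegrable
  have hsmall : ∀ v : ℝ, 0 ≤ v → v ≤ 1 →
      ∫ t in (0 : ℝ)..v, 2 * min t (t ^ (κ - 1)) = v ^ (2 : ℝ) := by
    intro v hv hv1
    rw [intervalIntegral.integral_congr (g := fun t => 2 * t)]
    · rw [intervalIntegral.integral_const_mul, integral_id, Real.rpow_two]; ring
    · intro t ht
      rw [uIcc_of_le hv] at ht
      have h0 : t ≤ t ^ (κ - 1) := by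
        rcases ht.1.eq_or_lt with h | h
        · rw [← h]; positivity
        · calc t = t ^ (1 : ℝ) := (Real.rpow_one t).symm
            _ ≤ _ := Real.rpow_le_rpow_of_exponent_ge h (ht.2.trans hv1) (by linarith)
      simp only [min_eq_left h0]
  rcases le_or_gt u 1 with h | h
  · rw [hsmall u hu h]; exact min_le_left _ _
  · rw [← intervalIntegral.integral_add_adjacent_intervals (hII 0 1) (hII 1 u),
      hsmall 1 zero_le_one le_rfl, intervalIntegral.integral_congr (a := 1) (b := u)
        (g := fun t => 2 * t ^ (κ - 1))]
    · rw [intervalIntegral.integral_const_mul, integral_rpow (Or.inl (by linarith))]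
      refine (min_le_right _ _).trans ?_
      have h1 : 1 ≤ u ^ κ := Real.one_le_rpow h.le (by linarith)
      rw [Real.one_rpow, sub_add_cancel, Real.one_rpow, mul_div_assoc', ← sub_le_iff_le_add',
        le_div_iff₀ (by linarith)]
      nlinarith
    · intro t ht
      rw [uIcc_of_le h.le] at ht
      have h0 : t ^ (κ - 1) ≤ t := by
        calc t ^ (κ - 1) ≤ t ^ (1 : ℝ) := Real.rpow_le_rpow_of_exponent_le ht.1 (by linarith)
          _ = t := Real.rpow_one t
      simp only [min_eq_right h0]

lemma integrableOn_rpow_mul_min {α κ : ℝ} (hα : α < 2) (hκ : 1 ≤ κ) (hκα : κ < α) :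
    IntegrableOn (fun t : ℝ => t ^ (-α) * (2 * min t (t ^ (κ - 1)))) (Ioi 0) := by
  have hmeas : Measurable fun t : ℝ => t ^ (-α) * (2 * min t (t ^ (κ - 1))) := by fun_prop
  rw [← Ioc_union_Ioi_eq_Ioi (zero_le_one' ℝ)]
  refine IntegrableOn.union ?_ ?_
  · have hi : IntegrableOn (fun u : ℝ => 2 * u ^ (1 - α)) (Ioc 0 1) := by
      rw [← intervalIntegrable_iff_integrableOn_Ioc_of_le zero_le_one]
      exact (intervalIntegral.intervalIntegrable_rpow' (by linarith)).const_mul 2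
    refine Integrable.mono' hi hmeas.aestronglyMeasurable
      ((ae_restrict_iff' measurableSet_Ioc).2 (Eventually.of_forall fun u hu => ?_))
    have hu0 : 0 < u := hu.1
    rw [Real.norm_of_nonneg (by positivity), show 1 - α = -α + 1 by ring, Real.rpow_add hu0,
      Real.rpow_one, mul_left_comm]
    gcongr
    exact min_le_left _ _
  · have hi : IntegrableOn (fun u : ℝ => 2 * u ^ (κ - 1 - α)) (Ioi 1) :=
      (integrableOn_Ioi_rpow_of_lt (by linarith) one_pos).const_mul 2
    refine Integrable.mono' hi hmeas.aestronglyMeasurable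
      ((ae_restrict_iff' measurableSet_Ioi).2 (Eventually.of_forall fun u hu => ?_))
    have hu1 : 1 < u := hu
    have hu0 : 0 < u := by linarith
    rw [Real.norm_of_nonneg (by positivity), show κ - 1 - α = -α + (κ - 1) by ring,
      Real.rpow_add hu0, mul_left_comm]
    gcongr
    exact min_le_right _ _

/-- Uniform consequences of the tail condition for the increments from states `x ≥ x₀`. -/
structure IncrementBounds (P : Kernel X X) (α β' C B x₀ : ℝ) : Prop where
  one_le : 1 ≤ x₀
  alpha_lt : α < β'
  le_two : β' ≤ 2
  C_pos : 0 < C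
  B_nonneg : 0 ≤ B
  upper : ∀ x : X, x₀ ≤ (x : ℝ) → ∀ t : ℝ, 0 < t →
    (P x).real {z : X | t < max ((z : ℝ) - x) 0} ≤ C * t ^ (-α)
  lower : ∀ x : X, x₀ ≤ (x : ℝ) →
    ∫⁻ z : X, ENNReal.ofReal (max (-((z : ℝ) - x)) 0 ^ β') ∂(P x) ≤ ENNReal.ofReal B

lemma TailCondition.incrementBounds {P : Kernel X X} [IsMarkovKernel P] {α β c : ℝ}
    (hT : TailCondition P α β c) : ∃ β' C B x₀, IncrementBounds P α β' C B x₀ := by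
  have hα := hT.one_lt
  have hα2 := hT.lt_two
  have hαβ := hT.alpha_lt_beta
  have hc := hT.c_pos
  obtain ⟨x₀, hx₀, hunif, hsup⟩ := hT.tails
  have h1 := Metric.tendstoUniformlyOn_iff.1 hunif 1 one_pos
  obtain ⟨y₀, hy₀⟩ := eventually_atTop.1 h1
  set S := ⨆ x : X, ⨆ _ : x₀ ≤ (x : ℝ),
      ∫⁻ z : X, ENNReal.ofReal (max (-((z : ℝ) - x)) 0 ^ β) ∂(P x) with hS
  set y₁ := max y₀ 1 with hy₁
  have hy₁1 : 1 ≤ y₁ := le_max_right _ _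
  -- Capping the exponent at 2 lets the lower moment control quadratic remainders, at the price
  -- s^(min β 2) ≤ 1 + s^β. The tail bound must hold for all t > 0: c + 1 serves t ≥ y₁, and y₁^α
  -- serves smaller t, where the probability is at most 1.
  refine ⟨min β 2, max (c + 1) (y₁ ^ α), 1 + S.toReal, max x₀ 1, ⟨le_max_right _ _,
    lt_min hαβ hα2, min_le_right _ _, lt_max_of_lt_left (by linarith), by positivity, ?_, ?_⟩⟩
  · intro x hx t ht
    have hx' : x₀ ≤ (x : ℝ) := (le_max_left _ _).trans hx
    have htα : 0 < t ^ α := Real.rpow_pos_of_pos ht α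
    rw [Real.rpow_neg ht.le, ← div_eq_mul_inv, le_div_iff₀ htα]
    rcases le_or_gt y₁ t with h | h
    · refine le_trans ?_ (le_max_left _ _)
      have := hy₀ t ((le_max_left _ _).trans h) x hx'
      rw [Real.dist_eq, abs_sub_comm, abs_lt] at this
      rw [mul_comm]; linarith [this.2]
    · refine le_trans ?_ (le_max_right _ _)
      calc _ ≤ 1 * t ^ α := by gcongr; exact measureReal_le_one
        _ ≤ y₁ ^ α := by rw [one_mul]; exact Real.rpow_le_rpow ht.le h.le (by linarith)
  · intro x hx
    have hx' : x₀ ≤ (x : ℝ) := (le_max_left _ _).trans hx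
    have hle : ∫⁻ z : X, ENNReal.ofReal (max (-((z : ℝ) - x)) 0 ^ β) ∂(P x) ≤ S :=
      le_iSup₂_of_le x hx' le_rfl
    calc ∫⁻ z : X, ENNReal.ofReal (max (-((z : ℝ) - x)) 0 ^ (min β 2)) ∂(P x)
        ≤ ∫⁻ z : X, (1 + ENNReal.ofReal (max (-((z : ℝ) - x)) 0 ^ β)) ∂(P x) := by
          refine lintegral_mono fun z => ?_
          rw [← ENNReal.ofReal_one, ← ENNReal.ofReal_add zero_le_one (by positivity)]
          refine ENNReal.ofReal_le_ofReal ?_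
          set s := max (-((z : ℝ) - x)) 0
          have hs : 0 ≤ s := le_max_right _ _
          rcases le_or_gt s 1 with h | h
          · have h1 := Real.rpow_le_one hs h (z := min β 2) (le_min (by linarith) (by norm_num))
            have h2 : 0 ≤ s ^ β := by positivity
            linarith
          · have h1 := Real.rpow_le_rpow_of_exponent_le h.le (min_le_left β 2)
            linarith
      _ = 1 + ∫⁻ z : X, ENNReal.ofReal (max (-((z : ℝ) - x)) 0 ^ β) ∂(P x) := by
          rw [lintegral_add_left measurable_const]; simp
      _ ≤ 1 + S := by gcongr
      _ = ENNReal.ofReal (1 + S.toReal) := by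
          rw [ENNReal.ofReal_add zero_le_one ENNReal.toReal_nonneg, ENNReal.ofReal_one,
            ENNReal.ofReal_toReal hsup.ne]

namespace IncrementBounds

variable {P : Kernel X X} {α β' C B x₀ : ℝ}

lemma measure_scaled_le (h : IncrementBounds P α β' C B x₀) {x : X} (hx : x₀ ≤ (x : ℝ)) {R : ℝ}
    (hR : 0 < R) {t : ℝ} (ht : 0 < t) :
    (P x).real {z : X | t < max ((z : ℝ) - x) 0 / R} ≤ C * R ^ (-α) * t ^ (-α) := by
  have h1 := h.upper x hx (R * t) (by positivity)
  rw [Real.mul_rpow hR.le ht.le, ← mul_assoc] at h1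
  convert h1 using 3
  ext z
  rw [lt_div_iff₀ hR, mul_comm]

variable [IsMarkovKernel P]

lemma lintegral_comp_le (h : IncrementBounds P α β' C B x₀) {x : X} (hx : x₀ ≤ (x : ℝ)) {R : ℝ}
    (hR : 0 < R) {g : ℝ → ℝ} (hg : ∀ t > 0, IntervalIntegrable g volume 0 t)
    (hg0 : ∀ t ∈ Ioi (0 : ℝ), 0 ≤ g t) (hint : IntegrableOn (fun t => t ^ (-α) * g t) (Ioi 0)) :
    ∫⁻ z : X, ENNReal.ofReal (∫ t in (0 : ℝ)..(max ((z : ℝ) - x) 0 / R), g t) ∂(P x) ≤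
      ENNReal.ofReal (C * R ^ (-α) * ∫ t in Ioi (0 : ℝ), t ^ (-α) * g t) := by
  rw [lintegral_comp_eq_lintegral_meas_lt_mul (P x)
    (f := fun z : X => max ((z : ℝ) - x) 0 / R) (Eventually.of_forall fun z => by positivity)
    (by fun_prop) hg ((ae_restrict_iff' measurableSet_Ioi).2 (Eventually.of_forall hg0)),
    ENNReal.ofReal_mul (by have := h.C_pos; positivity), ofReal_integral_eq_lintegral_ofReal hint,
    ← lintegral_const_mul' _ _ ENNReal.ofReal_ne_top]
  · refine setLIntegral_mono' measurableSet_Ioi fun t ht => ?_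
    have ht' : 0 < t := ht
    rw [ENNReal.ofReal_mul (p := t ^ (-α)) (by positivity), ← mul_assoc]
    gcongr
    rw [← ENNReal.ofReal_mul (by have := h.C_pos; positivity),
      ← ENNReal.ofReal_toReal (measure_ne_top (P x) _)]
    exact ENNReal.ofReal_le_ofReal (h.measure_scaled_le hx hR ht')
  · refine (ae_restrict_iff' measurableSet_Ioi).2 (Eventually.of_forall fun t ht => ?_)
    have ht' : 0 < t := ht
    exact mul_nonneg (by positivity) (hg0 t ht)

/-- The basic error estimate at scale R. Upward jumps contribute R^(-α) because κ < α < 2 makes the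
layer-cake integral converge at both ends; downward jumps contribute R^(-β') ≤ R^(-α), since `cutPow
κ u` is at most u^β'. -/
lemma exists_lintegral_cutPow_le (h : IncrementBounds P α β' C B x₀) (hα2 : α < 2) {κ : ℝ}
    (hκ : 1 ≤ κ) (hκα : κ < α) :
    ∃ D : ℝ, 0 < D ∧ ∀ x : X, x₀ ≤ (x : ℝ) → ∀ R : ℝ, 1 ≤ R →
      ∫⁻ z : X, ENNReal.ofReal (cutPow κ (|(z : ℝ) - x| / R)) ∂(P x) ≤
        ENNReal.ofReal (D * R ^ (-α)) := by
  have hC := h.C_pos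
  have hB := h.B_nonneg
  have hI0 : 0 ≤ ∫ t in Ioi (0 : ℝ), t ^ (-α) * (2 * min t (t ^ (κ - 1))) :=
    setIntegral_nonneg measurableSet_Ioi fun t ht => by
      have ht : 0 < t := ht
      positivity
  set I := ∫ t in Ioi (0 : ℝ), t ^ (-α) * (2 * min t (t ^ (κ - 1))) with hI
  refine ⟨C * I + B + 1, by positivity, fun x hx R hR => ?_⟩
  have hR0 : 0 < R := by linarith
  have hup : ∫⁻ z : X, ENNReal.ofReal (cutPow κ (max ((z : ℝ) - x) 0 / R)) ∂(P x) ≤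
      ENNReal.ofReal (C * R ^ (-α) * I) := by
    refine le_trans (lintegral_mono fun z => ENNReal.ofReal_le_ofReal
      (cutPow_le_integral hκ (by linarith) (by positivity)))
      (h.lintegral_comp_le hx hR0 (g := fun t => 2 * min t (t ^ (κ - 1))) ?_ ?_
        (integrableOn_rpow_mul_min hα2 hκ hκα))
    · exact fun t _ => (continuousOn_min_rpow hκ _).intervalIntegrable
    · intro t ht
      have ht : 0 < t := ht
      positivity
  have hdown : ∫⁻ z : X, ENNReal.ofReal (cutPow κ (max (-((z : ℝ) - x)) 0 / R)) ∂(P x) ≤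
      ENNReal.ofReal (R ^ (-α) * B) := by
    calc _ ≤ ∫⁻ z : X, ENNReal.ofReal (R ^ (-β')) *
          ENNReal.ofReal (max (-((z : ℝ) - x)) 0 ^ β') ∂(P x) := by
          refine lintegral_mono fun z => ?_
          rw [← ENNReal.ofReal_mul (by positivity)]
          refine ENNReal.ofReal_le_ofReal ?_
          refine (cutPow_le_rpow (hκα.le.trans h.alpha_lt.le) h.le_two (by positivity)
            (by linarith [h.alpha_lt])).trans_eq ?_
          rw [Real.div_rpow (by positivity) hR0.le, Real.rpow_neg hR0.le]
          field_simp
      _ ≤ ENNReal.ofReal (R ^ (-β')) * ENNReal.ofReal B := by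
          rw [lintegral_const_mul' _ _ ENNReal.ofReal_ne_top]
          gcongr
          exact h.lower x hx
      _ ≤ _ := by
          rw [← ENNReal.ofReal_mul (by positivity)]
          refine ENNReal.ofReal_le_ofReal ?_
          gcongr ?_ * _
          exact Real.rpow_le_rpow_of_exponent_le hR (by linarith [h.alpha_lt])
  calc _ ≤ ∫⁻ z : X, (ENNReal.ofReal (cutPow κ (max ((z : ℝ) - x) 0 / R)) +
        ENNReal.ofReal (cutPow κ (max (-((z : ℝ) - x)) 0 / R))) ∂(P x) := by
        refine lintegral_mono fun z => ?_
        rcases le_total 0 ((z : ℝ) - x) with h0 | h0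
        · rw [abs_of_nonneg h0, max_eq_left h0]; exact le_self_add
        · rw [abs_of_nonpos h0, max_eq_left (neg_nonneg.2 h0)]; exact le_add_self
    _ = _ := lintegral_add_left (by fun_prop) _
    _ ≤ _ := add_le_add hup hdown
    _ ≤ _ := by
        rw [← ENNReal.ofReal_add (by positivity) (by positivity)]
        refine ENNReal.ofReal_le_ofReal ?_
        have : 0 < R ^ (-α) := by positivity
        nlinarith

lemma integrable_of_lintegral_le {μ : Measure X} {f : X → ℝ} (hf : Measurable f)
    (hf0 : ∀ z, 0 ≤ f z) {M : ℝ} (hM : ∫⁻ z, ENNReal.ofReal (f z) ∂μ ≤ ENNReal.ofReal M) :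
    Integrable f μ :=
  ⟨hf.aestronglyMeasurable, (hasFiniteIntegral_iff_ofReal (Eventually.of_forall hf0)).2
    (hM.trans_lt ENNReal.ofReal_lt_top)⟩

lemma integral_le_of_lintegral_le {μ : Measure X} {f : X → ℝ} (hf : Measurable f)
    (hf0 : ∀ z, 0 ≤ f z) {M : ℝ} (hM0 : 0 ≤ M)
    (hM : ∫⁻ z, ENNReal.ofReal (f z) ∂μ ≤ ENNReal.ofReal M) : ∫ z, f z ∂μ ≤ M := by
  rw [integral_eq_lintegral_of_nonneg_ae (Eventually.of_forall hf0) hf.aestronglyMeasurable]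
  exact (ENNReal.toReal_mono ENNReal.ofReal_ne_top hM).trans_eq (ENNReal.toReal_ofReal hM0)

/-- From |θ| ≤ 1 + `cutPow 1 |θ|`. Hence `drift` is a genuine expectation at these states, not the
default value of the integral. -/
lemma integrable_increment (h : IncrementBounds P α β' C B x₀) (hα : 1 < α) (hα2 : α < 2)
    {x : X} (hx : x₀ ≤ (x : ℝ)) : Integrable (fun z : X => (z : ℝ) - x) (P x) := by
  obtain ⟨D, hD, hcut⟩ := h.exists_lintegral_cutPow_le hα2 le_rfl hα
  have hi := integrable_of_lintegral_le (by fun_prop)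
    (fun z => cutPow_nonneg (by positivity)) (hcut x hx 1 le_rfl)
  refine Integrable.mono' ((integrable_const (1 : ℝ)).add hi) (by fun_prop)
    (Eventually.of_forall fun z => ?_)
  simp only [Pi.add_apply, div_one, Real.norm_eq_abs]
  rcases le_or_gt |(z : ℝ) - x| 1 with h1 | h1
  · linarith [cutPow_nonneg (κ := 1) (abs_nonneg ((z : ℝ) - x))]
  · have : cutPow 1 |(z : ℝ) - x| = |(z : ℝ) - x| := by
      rw [cutPow, Real.rpow_one, min_eq_right]
      rw [Real.rpow_two]; nlinarith
    linarith

/-- Lower bound for the drift of a semiconvex function. -/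
lemma le_integral_of_semiconvex (h : IncrementBounds P α β' C B x₀) (hα : 1 < α) (hα2 : α < 2) :
    ∃ D : ℝ, 0 < D ∧ ∀ x : X, x₀ ≤ (x : ℝ) → ∀ R : ℝ, 1 ≤ R → ∀ (g : X → ℝ) (p L : ℝ), 0 ≤ L →
      Integrable g (P x) →
      (∀ z : X, g x + p * ((z : ℝ) - x) - L * cutPow 1 (|(z : ℝ) - x| / R) ≤ g z) →
      g x + p * drift P x - L * (D * R ^ (-α)) ≤ ∫ z, g z ∂(P x) := by
  obtain ⟨D, hD, hcut⟩ := h.exists_lintegral_cutPow_le hα2 le_rfl hα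
  refine ⟨D, hD, fun x hx R hR g p L hL hg hsc => ?_⟩
  have hR0 : 0 < R := by linarith
  have hi := integrable_of_lintegral_le (by fun_prop)
    (fun z => cutPow_nonneg (by positivity)) (hcut x hx R hR)
  have hle := integral_le_of_lintegral_le (by fun_prop)
    (fun z => cutPow_nonneg (by positivity)) (by positivity) (hcut x hx R hR)
  have hθ := h.integrable_increment hα hα2 hx
  have := integral_mono (((integrable_const (g x)).add (hθ.const_mul p)).sub (hi.const_mul L)) hg
    hsc
  refine le_trans ?_ this
  rw [integral_sub' ((integrable_const (g x)).add (hθ.const_mul p)) (hi.const_mul L),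
    integral_add' (integrable_const (g x)) (hθ.const_mul p), integral_const_mul,
    integral_const_mul, integral_const, probReal_univ, one_smul]
  have := mul_le_mul_of_nonneg_left hle hL
  unfold drift
  linarith

end IncrementBounds

/-! ### Asymptotic drift of powers -/

/-- The first-order Taylor remainder of `w ^ ν` at `w = 1`. -/
noncomputable def powRem (ν w : ℝ) : ℝ := w ^ ν - 1 - ν * (w - 1)

@[fun_prop]
lemma measurable_powRem (ν : ℝ) : Measurable (powRem ν) := by
  unfold powRem; fun_prop

lemma powRem_one (ν : ℝ) : powRem ν 1 = 0 := by simp [powRem]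

/-- Bernoulli's inequality for w^ν bounds the remainder on one side; applied to the second factor of
w^ν = w · w^(ν-1) it bounds it on the other, with defect exactly (ν - 1)(w - 1)². No restriction to
w near 1 is needed. -/
lemma abs_powRem_le {ν w : ℝ} (hν : 0 < ν) (hν2 : ν < 2) (hw : 0 ≤ w) :
    |powRem ν w| ≤ |ν - 1| * (w - 1) ^ 2 := by
  unfold powRem
  rcases hw.eq_or_lt with rfl | hw
  · rw [Real.zero_rpow hν.ne']
    refine le_of_eq ?_
    rw [show (0 : ℝ) - 1 - ν * (0 - 1) = ν - 1 by ring]; ring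
  · have e : w ^ ν = w * w ^ (ν - 1) := by
      nth_rewrite 2 [← Real.rpow_one w]
      rw [← Real.rpow_add hw]; congr 1; ring
    rw [e]
    rcases le_total 1 ν with h | h
    · have h1 := rpow_one_add_le_one_add_mul_self (s := w - 1) (by linarith) (p := ν - 1)
        (by linarith) (by linarith)
      have h2 := one_add_mul_self_le_rpow_one_add (s := w - 1) (by linarith) h
      rw [add_sub_cancel] at h1 h2
      rw [e] at h2
      rw [abs_of_nonneg (by linarith), abs_of_nonneg (by linarith)]
      nlinarith
    · have h1 := one_add_mul_le_rpow_of_neg (s := w - 1) (p := ν - 1) (by linarith)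
        (by linarith) (by linarith)
      have h2 := rpow_one_add_le_one_add_mul_self (s := w - 1) (by linarith) hν.le h
      rw [add_sub_cancel] at h1 h2
      rw [e] at h2
      rw [abs_of_nonpos (by linarith), abs_of_nonpos (by linarith)]
      nlinarith

lemma integral_eq_powRem {ν σ u : ℝ} (hu : 0 ≤ u) :
    ∫ t in (0 : ℝ)..u, σ * (ν * ((1 + t) ^ (ν - 1) - 1)) = σ * powRem ν (1 + u) := by
  have hpos : ∀ t ∈ uIcc 0 u, (0 : ℝ) < 1 + t := by
    intro t ht; rw [uIcc_of_le hu] at ht; linarith [ht.1]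
  rw [intervalIntegral.integral_eq_sub_of_hasDerivAt (f := fun t => σ * powRem ν (1 + t))]
  · simp [powRem_one]
  · intro t ht
    have h1 : HasDerivAt (fun t : ℝ => (1 + t) ^ ν) (1 * ν * (1 + t) ^ (ν - 1)) t :=
      ((hasDerivAt_id t).const_add 1).rpow_const (Or.inl (hpos t ht).ne')
    have h2 : HasDerivAt (fun t : ℝ => ν * (1 + t - 1)) (ν * 1) t :=
      (((hasDerivAt_id t).const_add 1).sub_const 1).const_mul ν
    exact (((h1.sub_const 1).sub h2).const_mul σ).congr_deriv (by ring)
  · refine ContinuousOn.intervalIntegrable fun t ht => ContinuousAt.continuousWithinAt ?_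
    exact (((ContinuousAt.rpow_const (by fun_prop) (Or.inl (hpos t ht).ne')).sub
      continuousAt_const).const_mul ν).const_mul σ

lemma intervalIntegrable_rpow_one_add (σ ν : ℝ) {u : ℝ} (hu : 0 < u) :
    IntervalIntegrable (fun t : ℝ => σ * (ν * ((1 + t) ^ (ν - 1) - 1))) volume 0 u := by
  refine ContinuousOn.intervalIntegrable fun t ht => ContinuousAt.continuousWithinAt ?_
  rw [uIcc_of_le hu.le] at ht
  exact (((ContinuousAt.rpow_const (by fun_prop) (Or.inl (by linarith [ht.1]))).sub
    continuousAt_const).const_mul ν).const_mul σ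

/-- The layer-cake formula needs a nonnegative density; for upward jumps its sign depends only on
whether ν ≥ 1. The factor σ is carried along and removed by σ² = 1. -/
lemma exists_sign_rpow_one_add {ν : ℝ} (hν : 0 < ν) :
    ∃ σ : ℝ, σ * σ = 1 ∧ ∀ t : ℝ, 0 ≤ t → 0 ≤ σ * (ν * ((1 + t) ^ (ν - 1) - 1)) := by
  rcases le_total 1 ν with h | h
  · refine ⟨1, by norm_num, fun t ht => ?_⟩
    have := Real.one_le_rpow (x := 1 + t) (by linarith) (show 0 ≤ ν - 1 by linarith)
    have : 0 ≤ ν * ((1 + t) ^ (ν - 1) - 1) := mul_nonneg hν.le (by linarith)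
    linarith
  · refine ⟨-1, by norm_num, fun t ht => ?_⟩
    have := Real.rpow_le_one_of_one_le_of_nonpos (x := 1 + t) (by linarith)
      (show ν - 1 ≤ 0 by linarith)
    have : ν * ((1 + t) ^ (ν - 1) - 1) ≤ 0 := mul_nonpos_of_nonneg_of_nonpos hν.le (by linarith)
    linarith

lemma eventually_state_ge (r : ℝ) :
    ∀ᶠ x : X in comap (fun x : X => (x : ℝ)) atTop, r ≤ (x : ℝ) :=
  tendsto_comap.eventually (eventually_ge_atTop r)

/-- The tail is evaluated at the level xt, which moves with the state; this is where its uniformity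
in x enters. -/
lemma TailCondition.tendsto_scaled_tail {P : Kernel X X} {α β c : ℝ}
    (hT : TailCondition P α β c) {t : ℝ} (ht : 0 < t) :
    Tendsto (fun x : X => (x : ℝ) ^ α * (P x).real {z : X | t < max ((z : ℝ) - x) 0 / x})
      (comap (fun x : X => (x : ℝ)) atTop) (𝓝 (c * t ^ (-α))) := by
  obtain ⟨x₀, hx₀, hunif, -⟩ := hT.tails
  have h1 : Tendsto (fun x : X => ((x : ℝ) * t) ^ α *
      (P x).real {z : X | (x : ℝ) * t < max ((z : ℝ) - x) 0})
      (comap (fun x : X => (x : ℝ)) atTop) (𝓝 c) := by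
    rw [Metric.tendsto_nhds]
    intro ε hε
    have h2 := Metric.tendstoUniformlyOn_iff.1 hunif ε hε
    have h3 : Tendsto (fun x : X => (x : ℝ) * t) (comap (fun x : X => (x : ℝ)) atTop) atTop :=
      tendsto_comap.atTop_mul_const ht
    filter_upwards [h3.eventually h2, eventually_state_ge x₀] with x hx hx'
    rw [dist_comm]
    exact hx x hx'
  have h2 := h1.mul_const (t ^ (-α))
  refine h2.congr' ?_
  filter_upwards [eventually_state_ge 1] with x hx
  have hx0 : 0 < (x : ℝ) := by linarith
  have hset : {z : X | (x : ℝ) * t < max ((z : ℝ) - x) 0} =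
      {z : X | t < max ((z : ℝ) - x) 0 / x} := by
    ext z
    simp only [mem_ofPred_eq, lt_div_iff₀ hx0, mul_comm]
  have htt : t ^ α * t ^ (-α) = 1 := by rw [← Real.rpow_add ht]; simp
  rw [hset, Real.mul_rpow hx0.le ht.le]
  linear_combination ((x : ℝ) ^ α * (P x).real {z : X | t < max ((z : ℝ) - x) 0 / x}) * htt

namespace IncrementBounds

variable {P : Kernel X X} {α β' C B x₀ : ℝ}

lemma integrable_lower (h : IncrementBounds P α β' C B x₀) {x : X} (hx : x₀ ≤ (x : ℝ)) :
    Integrable (fun z : X => max (-((z : ℝ) - x)) 0 ^ β') (P x) :=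
  integrable_of_lintegral_le (by fun_prop) (fun z => by positivity) (h.lower x hx)

/-- A chain on the half-line cannot fall by more than x, so the relative fall s is at most 1 and s²
≤ s^β'. -/
lemma powRem_down_le (hX : ∀ x ∈ X, 0 ≤ x) {ν : ℝ} (hν : 0 < ν) (hν2 : ν < 2) (hβ : 0 < β')
    (hβ2 : β' ≤ 2) {x : X} (hx : 0 < (x : ℝ)) (z : X) :
    |powRem ν (1 - max (-((z : ℝ) - x)) 0 / x)| ≤
      (x : ℝ) ^ (-β') * max (-((z : ℝ) - x)) 0 ^ β' := by
  have hz := hX z z.2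
  set s := max (-((z : ℝ) - x)) 0 / x with hs
  have hs0 : 0 ≤ s := by positivity
  have hs1 : s ≤ 1 := by
    rw [hs, div_le_one hx]; exact max_le (by linarith) hx.le
  have h1 := abs_powRem_le hν hν2 (w := 1 - s) (by linarith)
  have h2 : |ν - 1| ≤ 1 := abs_le.2 ⟨by linarith, by linarith⟩
  have h3 : s ^ (2 : ℝ) ≤ s ^ β' := by
    rcases hs0.eq_or_lt with h0 | h0
    · rw [← h0, Real.zero_rpow hβ.ne']; norm_num
    · exact Real.rpow_le_rpow_of_exponent_ge h0 hs1 hβ2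
  have h4 : (x : ℝ) ^ (-β') * max (-((z : ℝ) - x)) 0 ^ β' = s ^ β' := by
    rw [hs, Real.div_rpow (by positivity) hx.le, Real.rpow_neg hx.le]; field_simp
  rw [h4]
  rw [Real.rpow_two] at h3
  nlinarith [sq_nonneg s]

lemma integrable_powRem_down (h : IncrementBounds P α β' C B x₀) (hX : ∀ x ∈ X, 0 ≤ x)
    (hα : 1 < α) {ν : ℝ} (hν : 0 < ν) (hν2 : ν < 2) {x : X} (hx : x₀ ≤ (x : ℝ)) :
    Integrable (fun z : X => powRem ν (1 - max (-((z : ℝ) - x)) 0 / x)) (P x) :=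
  Integrable.mono' ((h.integrable_lower hx).const_mul _)
    (Measurable.aestronglyMeasurable (by fun_prop)) (Eventually.of_forall
    (powRem_down_le hX hν hν2 (by linarith [h.alpha_lt]) h.le_two (by linarith [h.one_le])))

/-- Downward jumps contribute O(x^(-β')), which is o(x^(-α)) because β' > α. -/
lemma tendsto_powRem_down (h : IncrementBounds P α β' C B x₀) (hX : ∀ x ∈ X, 0 ≤ x)
    (hα : 1 < α) {ν : ℝ} (hν : 0 < ν) (hν2 : ν < 2) :
    Tendsto (fun x : X => (x : ℝ) ^ α *
        ∫ z : X, powRem ν (1 - max (-((z : ℝ) - x)) 0 / x) ∂(P x))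
      (comap (fun x : X => (x : ℝ)) atTop) (𝓝 0) := by
  have hlim : Tendsto (fun x : X => B * (x : ℝ) ^ (-(β' - α)))
      (comap (fun x : X => (x : ℝ)) atTop) (𝓝 0) := by
    have := ((tendsto_rpow_neg_atTop (sub_pos.2 h.alpha_lt)).comp
      (tendsto_comap (f := fun x : X => (x : ℝ)))).const_mul B
    rwa [mul_zero] at this
  refine squeeze_zero_norm' ?_ hlim
  filter_upwards [eventually_state_ge x₀] with x hx
  have hx0 : 0 < (x : ℝ) := by linarith [h.one_le]
  have hle := integral_le_of_lintegral_le (by fun_prop) (fun z => by positivity) h.B_nonneg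
    (h.lower x hx)
  rw [norm_mul, Real.norm_of_nonneg (by positivity)]
  calc _ ≤ (x : ℝ) ^ α * ∫ z : X, (x : ℝ) ^ (-β') * max (-((z : ℝ) - x)) 0 ^ β' ∂(P x) := by
        gcongr
        exact norm_integral_le_of_norm_le ((h.integrable_lower hx).const_mul _)
          (Eventually.of_forall
            (powRem_down_le hX hν hν2 (by linarith [h.alpha_lt]) h.le_two hx0))
    _ ≤ (x : ℝ) ^ α * ((x : ℝ) ^ (-β') * B) := by
        rw [integral_const_mul]; gcongr
    _ = _ := by
        rw [show -(β' - α) = α + -β' by ring, Real.rpow_add hx0]; ring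

variable [IsMarkovKernel P]

lemma integrable_powRem_up (h : IncrementBounds P α β' C B x₀) (hα : 1 < α) (hα2 : α < 2)
    {ν : ℝ} (hν : 0 < ν) (hνα : ν < α) {x : X} (hx : x₀ ≤ (x : ℝ)) :
    Integrable (fun z : X => powRem ν (1 + max ((z : ℝ) - x) 0 / x)) (P x) := by
  obtain ⟨σ, hσ, hpos⟩ := exists_sign_rpow_one_add hν
  have hx0 : 0 < (x : ℝ) := by linarith [h.one_le]
  have hint : IntegrableOn (fun t : ℝ => t ^ (-α) * (σ * (ν * ((1 + t) ^ (ν - 1) - 1))))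
      (Ioi 0) :=
    IntegrableOn.congr_fun ((integrableOn_rpow_one_add_sub_one_mul hα hα2 hν hνα).const_mul
      (σ * ν)) (fun t _ => by ring) measurableSet_Ioi
  have hle := h.lintegral_comp_le hx hx0 (fun t ht => intervalIntegrable_rpow_one_add σ ν ht)
    (fun t ht => hpos t (le_of_lt ht)) hint
  have e : ∀ z : X, ∫ t in (0 : ℝ)..(max ((z : ℝ) - x) 0 / x),
      σ * (ν * ((1 + t) ^ (ν - 1) - 1)) = σ * powRem ν (1 + max ((z : ℝ) - x) 0 / x) :=
    fun z => integral_eq_powRem (by positivity)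
  simp_rw [e] at hle
  have hi := integrable_of_lintegral_le (by fun_prop) (fun z => by
    rw [← e]
    exact intervalIntegral.integral_nonneg (by positivity) fun t ht => hpos t ht.1) hle
  refine (hi.const_mul σ).congr (Eventually.of_forall fun z => ?_)
  simp only [← mul_assoc, hσ, one_mul]

/-- The layer-cake formula turns the expectation into the integral of ℙ_x(θ₊/x > t) against ν((1 +
t)^(ν-1) - 1). Multiplied by x^α, the tail converges to c t^(-α) and is dominated by C t^(-α), so
dominated convergence applies. -/
lemma tendsto_powRem_up (h : IncrementBounds P α β' C B x₀) {β c : ℝ}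
    (hT : TailCondition P α β c) {ν : ℝ} (hν : 0 < ν) (hνα : ν < α) :
    Tendsto (fun x : X => (x : ℝ) ^ α *
        ∫ z : X, powRem ν (1 + max ((z : ℝ) - x) 0 / x) ∂(P x))
      (comap (fun x : X => (x : ℝ)) atTop) (𝓝 (c * (ν * stableDrift α ν))) := by
  have hα := hT.one_lt
  have hα2 := hT.lt_two
  obtain ⟨σ, hσ, hpos⟩ := exists_sign_rpow_one_add hν
  set g : ℝ → ℝ := fun t => σ * (ν * ((1 + t) ^ (ν - 1) - 1)) with hg
  have hgm : Measurable g := by fun_prop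
  have hint : IntegrableOn (fun t : ℝ => C * t ^ (-α) * g t) (Ioi 0) :=
    IntegrableOn.congr_fun ((integrableOn_rpow_one_add_sub_one_mul hα hα2 hν hνα).const_mul
      (C * σ * ν)) (fun t _ => by simp only [hg]; ring) measurableSet_Ioi
  have hrepr : ∀ x : X, x₀ ≤ (x : ℝ) →
      ∫ z : X, σ * powRem ν (1 + max ((z : ℝ) - x) 0 / x) ∂(P x) =
      ∫ t in Ioi (0 : ℝ), (P x).real {z : X | t < max ((z : ℝ) - x) 0 / x} * g t := by
    intro x hx
    have hx0 : 0 < (x : ℝ) := by linarith [h.one_le]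
    have e : ∀ z : X, ∫ t in (0 : ℝ)..(max ((z : ℝ) - x) 0 / x), g t =
        σ * powRem ν (1 + max ((z : ℝ) - x) 0 / x) :=
      fun z => integral_eq_powRem (by positivity)
    have hanti : Antitone fun t : ℝ => (P x).real {z : X | t < max ((z : ℝ) - x) 0 / x} :=
      fun s t hst => measureReal_mono fun z (hz : t < _) => lt_of_le_of_lt hst hz
    rw [integral_eq_lintegral_of_nonneg_ae (Eventually.of_forall fun z => ?_)
        (Measurable.aestronglyMeasurable (by fun_prop)),
      integral_eq_lintegral_of_nonneg_ae (f := fun t => (P x).real {z : X |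
        t < max ((z : ℝ) - x) 0 / x} * g t) ?_ (hanti.measurable.mul hgm).aestronglyMeasurable]
    · congr 1
      simp_rw [← e]
      rw [lintegral_comp_eq_lintegral_meas_lt_mul (P x)
        (f := fun z : X => max ((z : ℝ) - x) 0 / x) (Eventually.of_forall fun z => by positivity)
        (by fun_prop) (fun t ht => intervalIntegrable_rpow_one_add σ ν ht)
        ((ae_restrict_iff' measurableSet_Ioi).2
          (Eventually.of_forall fun t ht => hpos t (le_of_lt ht)))]
      refine lintegral_congr fun t => ?_
      rw [ENNReal.ofReal_mul measureReal_nonneg, ofReal_measureReal]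
    · refine (ae_restrict_iff' measurableSet_Ioi).2 (Eventually.of_forall fun t ht => ?_)
      exact mul_nonneg measureReal_nonneg (hpos t (le_of_lt ht))
    · rw [← e]
      exact intervalIntegral.integral_nonneg (by positivity) fun t ht => hpos t ht.1
  have hDCT : Tendsto (fun x : X => ∫ t in Ioi (0 : ℝ),
      (x : ℝ) ^ α * (P x).real {z : X | t < max ((z : ℝ) - x) 0 / x} * g t)
      (comap (fun x : X => (x : ℝ)) atTop) (𝓝 (∫ t in Ioi (0 : ℝ), c * t ^ (-α) * g t)) := by
    refine tendsto_integral_filter_of_dominated_convergence (fun t => C * t ^ (-α) * g t)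
      ?_ ?_ hint ?_
    · refine Eventually.of_forall fun x => ?_
      have hanti : Antitone fun t : ℝ => (P x).real {z : X | t < max ((z : ℝ) - x) 0 / x} :=
        fun s t hst => measureReal_mono fun z (hz : t < _) => lt_of_le_of_lt hst hz
      exact ((hanti.measurable.const_mul _).mul hgm).aestronglyMeasurable
    · filter_upwards [eventually_state_ge x₀] with x hx
      have hx0 : 0 < (x : ℝ) := by linarith [h.one_le]
      refine (ae_restrict_iff' measurableSet_Ioi).2 (Eventually.of_forall fun t ht => ?_)
      have ht' : 0 < t := ht
      have hg0 : 0 ≤ g t := hpos t ht'.le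
      rw [Real.norm_of_nonneg (by positivity)]
      refine mul_le_mul_of_nonneg_right ?_ hg0
      have h1 := h.measure_scaled_le hx hx0 ht'
      have h2 := mul_le_mul_of_nonneg_left h1 (show 0 ≤ (x : ℝ) ^ α by positivity)
      refine h2.trans_eq ?_
      have hxx : (x : ℝ) ^ α * (x : ℝ) ^ (-α) = 1 := by rw [← Real.rpow_add hx0]; simp
      linear_combination (C * t ^ (-α)) * hxx
    · refine (ae_restrict_iff' measurableSet_Ioi).2 (Eventually.of_forall fun t ht => ?_)
      exact (hT.tendsto_scaled_tail ht).mul_const _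
  have hval : ∫ t in Ioi (0 : ℝ), c * t ^ (-α) * g t = σ * (c * (ν * stableDrift α ν)) := by
    rw [show (fun t : ℝ => c * t ^ (-α) * g t) = fun t => (σ * c * ν) *
      (((1 + t) ^ (ν - 1) - 1) * t ^ (-α)) by ext t; simp only [hg]; ring, integral_const_mul]
    unfold stableDrift; ring
  rw [hval] at hDCT
  have h2 := hDCT.const_mul σ
  rw [← mul_assoc, hσ, one_mul] at h2
  refine h2.congr' ?_
  filter_upwards [eventually_state_ge x₀] with x hx
  simp_rw [mul_assoc]
  rw [integral_const_mul, ← hrepr x hx, integral_const_mul]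
  linear_combination ((x : ℝ) ^ α * ∫ z : X, powRem ν (1 + max ((z : ℝ) - x) 0 / x) ∂(P x)) * hσ

/-- At most one of θ₊ and θ₋ is nonzero, and the remainder vanishes at 1. -/
lemma powRem_div (x z : X) (hx : 0 < (x : ℝ)) (ν : ℝ) :
    powRem ν ((z : ℝ) / x) = powRem ν (1 + max ((z : ℝ) - x) 0 / x) +
      powRem ν (1 - max (-((z : ℝ) - x)) 0 / x) := by
  have hx' := hx.ne'
  rcases le_total 0 ((z : ℝ) - x) with h | h
  · rw [max_eq_left h, max_eq_right (by linarith), zero_div, sub_zero, powRem_one, add_zero]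
    congr 1; field_simp; ring
  · rw [max_eq_right h, max_eq_left (by linarith), zero_div, add_zero, powRem_one, zero_add]
    congr 1; field_simp; ring

lemma rpow_eq_powRem (hX : ∀ x ∈ X, 0 ≤ x) (x z : X) (hx : 0 < (x : ℝ)) (ν : ℝ) :
    (z : ℝ) ^ ν = (x : ℝ) ^ ν * (powRem ν (1 + max ((z : ℝ) - x) 0 / x) +
      powRem ν (1 - max (-((z : ℝ) - x)) 0 / x)) + ((x : ℝ) ^ ν +
      (x : ℝ) ^ ν * (ν / x) * ((z : ℝ) - x)) := by
  rw [← powRem_div x z hx, powRem, Real.div_rpow (hX z z.2) hx.le]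
  have := Real.rpow_pos_of_pos hx ν
  field_simp
  ring

lemma integrable_rpow (h : IncrementBounds P α β' C B x₀) (hX : ∀ x ∈ X, 0 ≤ x)
    (hα : 1 < α) (hα2 : α < 2) {ν : ℝ} (hν : 0 < ν) (hνα : ν < α) {x : X} (hx : x₀ ≤ (x : ℝ)) :
    Integrable (fun z : X => (z : ℝ) ^ ν) (P x) := by
  have hx0 : 0 < (x : ℝ) := by linarith [h.one_le]
  refine Integrable.congr ?_ (Eventually.of_forall fun z => (rpow_eq_powRem hX x z hx0 ν).symm)
  exact (((h.integrable_powRem_up hα hα2 hν hνα hx).add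
    (h.integrable_powRem_down hX hα hν (by linarith) hx)).const_mul _).add
    ((integrable_const _).add ((h.integrable_increment hα hα2 hx).const_mul _))

/-- The relative drift of `x ^ ν` in terms of the mean drift and the heavy tail. -/
lemma tendsto_rpow_drift (h : IncrementBounds P α β' C B x₀) (hX : ∀ x ∈ X, 0 ≤ x) {β c : ℝ}
    (hT : TailCondition P α β c) {ν : ℝ} (hν : 0 < ν) (hνα : ν < α) :
    Tendsto (fun x : X => (x : ℝ) ^ α *
        ((x : ℝ) ^ (-ν) * ∫ z : X, (z : ℝ) ^ ν ∂(P x) - 1 - ν * (drift P x / x)))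
      (comap (fun x : X => (x : ℝ)) atTop) (𝓝 (c * (ν * stableDrift α ν))) := by
  have hα := hT.one_lt
  have hα2 := hT.lt_two
  have h2 := (h.tendsto_powRem_up hT hν hνα).add (h.tendsto_powRem_down hX hα hν (by linarith))
  rw [add_zero] at h2
  refine h2.congr' ?_
  filter_upwards [eventually_state_ge x₀] with x hx
  have hx0 : 0 < (x : ℝ) := by linarith [h.one_le]
  have hi1 := h.integrable_powRem_up hα hα2 hν hνα hx
  have hi2 := h.integrable_powRem_down hX hα hν (by linarith) hx
  have hi3 := h.integrable_increment hα hα2 hx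
  have e : ∫ z : X, (z : ℝ) ^ ν ∂(P x) =
      (x : ℝ) ^ ν * (∫ z : X, powRem ν (1 + max ((z : ℝ) - x) 0 / x) ∂(P x) +
      ∫ z : X, powRem ν (1 - max (-((z : ℝ) - x)) 0 / x) ∂(P x)) + ((x : ℝ) ^ ν +
      (x : ℝ) ^ ν * (ν / x) * drift P x) := by
    have h4 : Integrable (fun z : X => (x : ℝ) ^ ν * (powRem ν (1 + max ((z : ℝ) - x) 0 / x) +
        powRem ν (1 - max (-((z : ℝ) - x)) 0 / x))) (P x) := (hi1.add hi2).const_mul _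
    have h5 : Integrable (fun z : X => (x : ℝ) ^ ν + (x : ℝ) ^ ν * (ν / x) * ((z : ℝ) - x))
        (P x) := (integrable_const _).add (hi3.const_mul _)
    rw [integral_congr_ae (Eventually.of_forall fun z => rpow_eq_powRem hX x z hx0 ν),
      integral_add h4 h5, integral_const_mul, integral_add hi1 hi2,
      integral_add (integrable_const _) (hi3.const_mul _), integral_const, integral_const_mul,
      probReal_univ, one_smul]
    rfl
  have hxx : (x : ℝ) ^ (-ν) * (x : ℝ) ^ ν = 1 := by rw [← Real.rpow_add hx0]; simp
  rw [e]
  generalize (x : ℝ) ^ ν = A at *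
  generalize (x : ℝ) ^ (-ν) = A' at *
  linear_combination (-(x : ℝ) ^ α * (∫ z : X, powRem ν (1 + max ((z : ℝ) - x) 0 / x) ∂(P x) +
      ∫ z : X, powRem ν (1 - max (-((z : ℝ) - x)) 0 / x) ∂(P x) + 1 + ν / x * drift P x)) * hxx

/-- Rescaled version of the drift asymptotics at the scale `x ^ (γ + 1)` of the mean drift. -/
lemma tendsto_rpow_drift_scale (h : IncrementBounds P α β' C B x₀) (hX : ∀ x ∈ X, 0 ≤ x)
    {β c γ b l : ℝ} (hT : TailCondition P α β c) {ν : ℝ} (hν : 0 < ν) (hνα : ν < α)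
    (hl : Tendsto (fun x : ℝ => x ^ (γ + 1 - α)) atTop (𝓝 l))
    (hD : Tendsto (fun x : X => (x : ℝ) ^ γ * drift P x)
      (comap (fun x : X => (x : ℝ)) atTop) (𝓝 b)) :
    Tendsto (fun x : X => (x : ℝ) ^ (γ + 1) *
        ((x : ℝ) ^ (-ν) * ∫ z : X, (z : ℝ) ^ ν ∂(P x) - 1))
      (comap (fun x : X => (x : ℝ)) atTop) (𝓝 (l * (c * (ν * stableDrift α ν)) + ν * b)) := by
  -- The limit `l` weighs the jump term: it is 1 when γ + 1 = α and 0 when γ + 1 < α.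
  have h2 := ((hl.comp (tendsto_comap (f := fun x : X => (x : ℝ)))).mul
    (h.tendsto_rpow_drift hX hT hν hνα)).add (hD.const_mul ν)
  refine h2.congr' ?_
  filter_upwards [eventually_state_ge 1] with x hx
  have hx0 : 0 < (x : ℝ) := by linarith
  have e1 : (x : ℝ) ^ (γ + 1) = (x : ℝ) ^ (γ + 1 - α) * (x : ℝ) ^ α := by
    rw [← Real.rpow_add hx0]; congr 1; ring
  have e2 : (x : ℝ) ^ (γ + 1) = (x : ℝ) ^ γ * x := by rw [Real.rpow_add hx0, Real.rpow_one]
  simp only [Function.comp]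
  rw [← mul_assoc ((x : ℝ) ^ (γ + 1 - α)), ← e1, e2]
  field_simp
  ring

end IncrementBounds

/-! ### Semiconvex test functions -/

/-- A `C^{1,1}` concave saturation: the identity on `(-∞, 1]` and constant on `[3, ∞)`. -/
noncomputable def saturate (u : ℝ) : ℝ := u - max (u - 1) 0 ^ 2 / 4 + max (u - 3) 0 ^ 2 / 4

/-- The derivative of `saturate`. -/
noncomputable def saturateDeriv (u : ℝ) : ℝ := 1 - max (u - 1) 0 / 2 + max (u - 3) 0 / 2

@[fun_prop]
lemma measurable_saturate : Measurable saturate := by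
  unfold saturate; fun_prop

lemma saturate_of_le {u : ℝ} (hu : u ≤ 1) : saturate u = u := by
  simp [saturate, max_eq_right (show u - 1 ≤ 0 by linarith),
    max_eq_right (show u - 3 ≤ 0 by linarith)]

lemma saturateDeriv_mem (u : ℝ) : saturateDeriv u ∈ Icc (0 : ℝ) 1 := by
  unfold saturateDeriv
  rcases max_cases (u - 1) 0 with h | h <;> rcases max_cases (u - 3) 0 with h' | h' <;>
    rw [h.1, h'.1] <;> constructor <;> linarith

lemma saturate_le_two (u : ℝ) : saturate u ≤ 2 := by
  unfold saturate
  rcases max_cases (u - 1) 0 with h | h <;> rcases max_cases (u - 3) 0 with h' | h' <;>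
    rw [h.1, h'.1] <;> nlinarith [sq_nonneg (u - 3)]

lemma one_le_saturate {u : ℝ} (hu : 1 ≤ u) : 1 ≤ saturate u := by
  unfold saturate
  rcases max_cases (u - 1) 0 with h | h <;> rcases max_cases (u - 3) 0 with h' | h' <;>
    rw [h.1, h'.1] <;> nlinarith

lemma sq_max_le (s t : ℝ) : max t 0 ^ 2 ≤ max s 0 ^ 2 + 2 * max s 0 * (t - s) + (t - s) ^ 2 := by
  rcases max_cases s 0 with h | h <;> rcases max_cases t 0 with h' | h' <;>
    rw [h.1, h'.1] <;> nlinarith [sq_nonneg t, sq_nonneg s]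

lemma le_sq_max (s t : ℝ) : max s 0 ^ 2 + 2 * max s 0 * (t - s) ≤ max t 0 ^ 2 := by
  rcases max_cases s 0 with h | h <;> rcases max_cases t 0 with h' | h' <;>
    rw [h.1, h'.1] <;> nlinarith [sq_nonneg t, sq_nonneg s, sq_nonneg (t - s)]

/-- Only the concave quadratic term falls below its tangent; the convex one stays above. -/
lemma saturate_semiconvex (u v : ℝ) :
    saturate u + saturateDeriv u * (v - u) - (v - u) ^ 2 / 4 ≤ saturate v := by
  have h1 := sq_max_le (u - 1) (v - 1)
  have h2 := le_sq_max (u - 3) (v - 3)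
  unfold saturate saturateDeriv
  linarith

lemma saturate_mono : Monotone saturate := by
  intro u v huv
  unfold saturate
  rcases max_cases (u - 1) 0 with h | h <;> rcases max_cases (u - 3) 0 with h' | h' <;>
    rcases max_cases (v - 1) 0 with k | k <;> rcases max_cases (v - 3) 0 with k' | k' <;>
    rw [h.1, h'.1, k.1, k'.1] <;> nlinarith

lemma abs_saturate_sub_le (u v : ℝ) : |saturate v - saturate u| ≤ |v - u| := by
  wlog huv : u ≤ v generalizing u v
  · rw [abs_sub_comm, abs_sub_comm v]; exact this v u (le_of_not_ge huv)
  rw [abs_of_nonneg (sub_nonneg.2 (saturate_mono huv)), abs_of_nonneg (by linarith)]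
  unfold saturate
  have h1 : max (u - 1) 0 - max (u - 3) 0 ≤ max (v - 1) 0 - max (v - 3) 0 := by
    rcases max_cases (u - 1) 0 with h | h <;> rcases max_cases (u - 3) 0 with h' | h' <;>
    rcases max_cases (v - 1) 0 with k | k <;> rcases max_cases (v - 3) 0 with k' | k' <;> linarith
  have h2 : max (u - 1) 0 ≤ max (v - 1) 0 := max_le_max_right 0 (by linarith)
  have h3 : max (u - 3) 0 ≤ max (v - 3) 0 := max_le_max_right 0 (by linarith)
  have h4 : max (u - 3) 0 ≤ max (u - 1) 0 := max_le_max_right 0 (by linarith)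
  have h5 : 0 ≤ max (u - 3) 0 := le_max_right _ _
  nlinarith

lemma saturate_nonneg {u : ℝ} (hu : 0 ≤ u) : 0 ≤ saturate u := by
  have := saturate_mono hu
  rwa [saturate_of_le zero_le_one] at this

/-- Semiconvexity of `saturate ^ ν` on the region `r ≤ saturate u`. -/
lemma saturate_rpow_semiconvex {ν r u v : ℝ} (hν : 0 < ν) (hν2 : ν < 2) (hr : 0 < r) (hr1 : r ≤ 1)
    (hu : r ≤ saturate u) (hv : 0 ≤ v) :
    saturate u ^ ν + ν * saturate u ^ (ν - 1) * saturateDeriv u * (v - u) -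
      2 ^ ν * (2 * ν + 2 / r) * cutPow 1 (|v - u| / r) ≤ saturate v ^ ν := by
  set t := saturate u with ht
  set s := saturate v with hs
  have ht0 : 0 < t := hr.trans_le hu
  have hs0 : 0 ≤ s := saturate_nonneg hv
  have ht2 : t ≤ 2 := saturate_le_two u
  have hs2 : s ≤ 2 := saturate_le_two v
  have hp := saturateDeriv_mem u
  set p := saturateDeriv u
  set δ := |v - u| / r with hδ
  have hδ0 : 0 ≤ δ := by positivity
  have hvu : |v - u| = r * δ := by rw [hδ]; field_simp
  have hst : |s - t| ≤ r * δ := hvu ▸ abs_saturate_sub_le u v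
  set m := cutPow 1 δ with hm
  have hm0 : 0 ≤ m := cutPow_nonneg hδ0
  have hmin : ∀ A : ℝ, A ≤ δ ^ 2 → A ≤ δ → A ≤ m := fun A h1 h2 =>
    le_min (by rwa [Real.rpow_two]) (by rwa [Real.rpow_one])
  -- The inner function deviates from its tangent quadratically for small increments and, being
  -- 1-Lipschitz, linearly for large ones; `cutPow 1` records the smaller bound.
  have hin : s - t - p * (v - u) ≥ -(2 * (r * m)) := by
    have h1 := saturate_semiconvex u v
    rw [← ht, ← hs, ← sq_abs, hvu] at h1
    have h2 : -(2 * (r * δ)) ≤ s - t - p * (v - u) := by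
      have h3 := (abs_le.1 hst).1
      have h4 : p * (v - u) ≤ 1 * |v - u| :=
        (mul_le_mul_of_nonneg_left (le_abs_self _) hp.1).trans
          (mul_le_mul_of_nonneg_right hp.2 (abs_nonneg _))
      rw [hvu] at h4
      linarith
    have h5 : (t + p * (v - u) - s) / (2 * r) ≤ m := by
      refine hmin _ ?_ ?_
      · rw [div_le_iff₀ (by positivity)]
        nlinarith [sq_nonneg δ, mul_pos hr hr, mul_nonneg hr.le (sq_nonneg δ)]
      · rw [div_le_iff₀ (by positivity)]; linarith
    rw [div_le_iff₀ (by positivity)] at h5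
    linarith
  -- The outer power is expanded in the ratio s/t. Since t ≥ r and s ≤ 2, |s/t - 1| is at most δ and
  -- also at most 2/r, so its square is again controlled by `m`.
  have hrem := (abs_le.1 (abs_powRem_le hν hν2 (w := s / t) (by positivity))).1
  have hν1 : |ν - 1| ≤ 1 := abs_le.2 ⟨by linarith, by linarith⟩
  have hw : |s / t - 1| ≤ δ := by
    rw [show s / t - 1 = (s - t) / t by field_simp, abs_div, abs_of_pos ht0, div_le_iff₀ ht0]
    nlinarith
  have hw2 : |s / t - 1| ≤ 2 / r := by
    have h1 : s / t ≤ 2 / r := by gcongr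
    have h2 : 0 ≤ s / t := by positivity
    have h3 : 1 ≤ 2 / r := by rw [le_div_iff₀ hr]; linarith
    exact abs_le.2 ⟨by linarith, by linarith⟩
  have hsq : (s / t - 1) ^ 2 ≤ 2 / r * m := by
    have h3 : 1 ≤ 2 / r := by rw [le_div_iff₀ hr]; linarith
    have h4 : (s / t - 1) ^ 2 / (2 / r) ≤ m := by
      refine hmin _ ?_ ?_
      · rw [div_le_iff₀ (by positivity), ← sq_abs]
        nlinarith [abs_nonneg (s / t - 1), sq_nonneg δ]
      · rw [div_le_iff₀ (by positivity), ← sq_abs]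
        nlinarith [abs_nonneg (s / t - 1)]
    rw [div_le_iff₀ (by positivity)] at h4
    linarith
  have htν : 0 < t ^ ν := by positivity
  have htν2 : t ^ ν ≤ 2 ^ ν := Real.rpow_le_rpow ht0.le ht2 hν.le
  have e1 : s ^ ν = t ^ ν * (1 + ν * (s / t - 1) + powRem ν (s / t)) := by
    rw [powRem, Real.div_rpow hs0 ht0.le]; field_simp; ring
  have e2 : t ^ (ν - 1) = t ^ ν / t := by rw [Real.rpow_sub_one ht0.ne']
  have h6 : ν * (s / t - 1) ≥ ν * (p * (v - u)) / t - 2 * ν * m := by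
    have h7 : (s - t) / t ≥ (p * (v - u) - 2 * (r * m)) / t :=
      div_le_div_of_nonneg_right (by linarith) ht0.le
    have h8 : 2 * (r * m) / t ≤ 2 * m := by
      rw [div_le_iff₀ ht0]; nlinarith
    rw [sub_div (p * (v - u))] at h7
    have h9 : s / t - 1 ≥ p * (v - u) / t - 2 * m := by
      rw [show s / t - 1 = (s - t) / t by field_simp]; linarith
    have := mul_le_mul_of_nonneg_left h9 hν.le
    rw [mul_div_assoc]; linarith
  have h10 : powRem ν (s / t) ≥ -(2 / r * m) := by nlinarith [sq_nonneg (s / t - 1)]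
  rw [e1, e2]
  have h11 : t ^ ν * (ν * (p * (v - u)) / t - (2 * ν + 2 / r) * m) ≤
      t ^ ν * (ν * (s / t - 1) + powRem ν (s / t)) := by gcongr; linarith
  have h12 : t ^ ν * ((2 * ν + 2 / r) * m) ≤ 2 ^ ν * ((2 * ν + 2 / r) * m) := by gcongr
  have e3 : ν * (t ^ ν / t) * p * (v - u) = t ^ ν * (ν * (p * (v - u)) / t) := by ring
  rw [e3]
  linarith

/-- A cutoff vanishing on `[0, 1]` and equal to `1` on `[2, ∞)`. -/
noncomputable def cutoff (u : ℝ) : ℝ := max 0 (1 - max (2 - u) 0 ^ 2)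

@[fun_prop]
lemma measurable_cutoff : Measurable cutoff := by unfold cutoff; fun_prop

lemma cutoff_nonneg (u : ℝ) : 0 ≤ cutoff u := le_max_left _ _

lemma cutoff_le_one (u : ℝ) : cutoff u ≤ 1 :=
  max_le zero_le_one (by linarith [sq_nonneg (max (2 - u) 0)])

lemma cutoff_of_le {u : ℝ} (hu : u ≤ 1) : cutoff u = 0 := by
  rw [cutoff, max_eq_left (by linarith : (0 : ℝ) ≤ 2 - u), max_eq_left]; nlinarith

lemma cutoff_of_two_le {u : ℝ} (hu : 2 ≤ u) : cutoff u = 1 := by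
  rw [cutoff, max_eq_right (by linarith : 2 - u ≤ 0)]; norm_num

/-- From u ≥ 1 the slope of the quadratic branch serves, because the truncation at 0 only raises the
function. For |v - u| > 1 the constant 3 absorbs the value, at most 1, and the linear term, at most
2|v - u|. -/
lemma cutoff_semiconvex {u : ℝ} (hu : 1 ≤ u) (v : ℝ) :
    cutoff u + 2 * max (2 - u) 0 * (v - u) - 3 * cutPow 1 |v - u| ≤ cutoff v := by
  have hw : max (2 - u) 0 ≤ 1 := max_le (by linarith) zero_le_one
  have hw0 : 0 ≤ max (2 - u) 0 := le_max_right _ _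
  have hcu : cutoff u = 1 - max (2 - u) 0 ^ 2 := max_eq_right (by nlinarith)
  rcases le_or_gt |v - u| 1 with h | h
  · have hcut : cutPow 1 |v - u| = (v - u) ^ 2 := by
      rw [cutPow, Real.rpow_one, Real.rpow_two, min_eq_left (by nlinarith [abs_nonneg (v - u)]),
        sq_abs]
    have h1 := sq_max_le (2 - u) (2 - v)
    have h2 : 1 - max (2 - v) 0 ^ 2 ≤ cutoff v := le_max_right _ _
    rw [hcut, hcu]
    nlinarith [sq_nonneg (v - u)]
  · have hcut : cutPow 1 |v - u| = |v - u| := by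
      rw [cutPow, Real.rpow_one, Real.rpow_two, min_eq_right (by nlinarith)]
    rw [hcut]
    have h1 := cutoff_nonneg v
    have h2 := cutoff_le_one u
    have h3 : max (2 - u) 0 * (v - u) ≤ |v - u| := by
      nlinarith [le_abs_self (v - u), abs_nonneg (v - u)]
    linarith

lemma ofReal_integral_le_lintegral {μ : Measure X} {g : X → ℝ} (hg : Integrable g μ) :
    ENNReal.ofReal (∫ z, g z ∂μ) ≤ ∫⁻ z, ENNReal.ofReal (g z) ∂μ := by
  have h1 : ∫ z, g z ∂μ ≤ ∫ z, max (g z) 0 ∂μ :=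
    integral_mono hg hg.pos_part fun z => le_max_left _ _
  refine (ENNReal.ofReal_le_ofReal h1).trans ?_
  rw [ofReal_integral_eq_lintegral_ofReal hg.pos_part
    (Eventually.of_forall fun z => le_max_right _ _)]
  refine lintegral_mono fun z => ?_
  rcases le_total 0 (g z) with h | h
  · rw [max_eq_left h]
  · rw [max_eq_right h]; simp

/-- Killing discards only states where g ≤ 0, so it cannot lower the positive part. -/
lemma ofReal_integral_le_killedStep (P : Kernel X X) {a : ℝ} {g : X → ℝ} {x : X}
    (hg : Integrable g (P x)) (hga : ∀ z : X, (z : ℝ) ≤ a → g z ≤ 0) :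
    ENNReal.ofReal (∫ z, g z ∂(P x)) ≤ killedStep P a (fun z => ENNReal.ofReal (g z)) x := by
  refine (ofReal_integral_le_lintegral hg).trans_eq ?_
  unfold killedStep
  rw [← lintegral_indicator (measurableSet_above a)]
  refine lintegral_congr fun z => ?_
  by_cases hz : a < (z : ℝ)
  · rw [indicator_of_mem (show z ∈ {z : X | a < (z : ℝ)} by simpa using hz)]
  · rw [indicator_of_notMem (show z ∉ {z : X | a < (z : ℝ)} by simpa using hz),
      ENNReal.ofReal_eq_zero.2 (hga z (not_lt.1 hz))]

/-- The power function `z ^ ν`, saturated at scale `S` and shifted to vanish at `a`. -/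
noncomputable def saturatedPow (ν S a z : ℝ) : ℝ := S ^ ν * saturate (z / S) ^ ν - a ^ ν

@[fun_prop]
lemma measurable_saturatedPow (ν S a : ℝ) : Measurable (saturatedPow ν S a) := by
  unfold saturatedPow; fun_prop

lemma saturatedPow_of_le {ν S a z : ℝ} (hS : 0 < S) (hz : 0 ≤ z) (hzS : z ≤ S) :
    saturatedPow ν S a z = z ^ ν - a ^ ν := by
  rw [saturatedPow, saturate_of_le ((div_le_one hS).2 hzS), Real.div_rpow hz hS.le]
  field_simp

lemma saturatedPow_le {ν S a z : ℝ} (hν : 0 < ν) (hS : 0 < S) (ha : 0 ≤ a) (hz : 0 ≤ z) :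
    saturatedPow ν S a z ≤ (2 * S) ^ ν := by
  have h1 : saturate (z / S) ^ ν ≤ 2 ^ ν :=
    Real.rpow_le_rpow (saturate_nonneg (by positivity)) (saturate_le_two _) hν.le
  have h2 : 0 ≤ a ^ ν := by positivity
  have h3 : S ^ ν * saturate (z / S) ^ ν ≤ S ^ ν * 2 ^ ν := by gcongr
  rw [saturatedPow, Real.mul_rpow (by norm_num) hS.le]; linarith

lemma integrable_saturatedPow {μ : Measure X} [IsFiniteMeasure μ] (hX : ∀ x ∈ X, 0 ≤ x)
    {ν S a : ℝ} (hν : 0 < ν) (hS : 0 < S) (ha : 0 ≤ a) :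
    Integrable (fun z : X => saturatedPow ν S a z) μ := by
  refine Integrable.of_bound (C := (2 * S) ^ ν + a ^ ν)
    (Measurable.aestronglyMeasurable (by fun_prop)) (Eventually.of_forall fun z => ?_)
  have hz := hX z z.2
  have h1 := saturatedPow_le hν hS ha hz
  have h2 : 0 ≤ a ^ ν := by positivity
  have h3 : 0 ≤ S ^ ν * saturate (z / S) ^ ν :=
    mul_nonneg (by positivity) (Real.rpow_nonneg (saturate_nonneg (by positivity)) _)
  have h4 : 0 ≤ (2 * S) ^ ν := by positivity
  rw [Real.norm_eq_abs, abs_le]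
  constructor
  · rw [saturatedPow]; linarith
  · linarith

/-- In units of KR, the condition y ≥ R keeps the saturated variable above 1/K, away from the
singularity of the power at 0. For fixed K the slope is O(R^(ν-1)) and the curvature constant
O(R^ν). -/
lemma saturatedPow_semiconvex {ν K R a y : ℝ} (hν : 0 < ν) (hν2 : ν < 2) (hK : 1 ≤ K)
    (hR : 0 < R) (hy : R ≤ y) :
    ∃ p : ℝ, 0 ≤ p ∧ p ≤ (K * R) ^ ν * (ν * 2 ^ ν) / R ∧ ∀ z : ℝ, 0 ≤ z →
      saturatedPow ν (K * R) a y + p * (z - y) -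
        (K * R) ^ ν * (2 ^ ν * (2 * ν + 2 * K)) * cutPow 1 (|z - y| / R) ≤
        saturatedPow ν (K * R) a z := by
  have hK0 : 0 < K := by linarith
  have hS : 0 < K * R := by positivity
  have hr1 : K⁻¹ ≤ 1 := inv_le_one_of_one_le₀ hK
  have hu : K⁻¹ ≤ saturate (y / (K * R)) := by
    rcases le_or_gt (y / (K * R)) 1 with h | h
    · rw [saturate_of_le h, le_div_iff₀ hS, ← mul_assoc, inv_mul_cancel₀ hK0.ne', one_mul]
      exact hy
    · exact hr1.trans (one_le_saturate h.le)
  set t := saturate (y / (K * R)) with ht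
  have ht0 : 0 < t := lt_of_lt_of_le (by positivity) hu
  have hp := saturateDeriv_mem (y / (K * R))
  refine ⟨(K * R) ^ ν * (ν * t ^ (ν - 1) * saturateDeriv (y / (K * R))) / (K * R), ?_, ?_, ?_⟩
  · have := hp.1; positivity
  · have h1 : t ^ (ν - 1) ≤ 2 ^ ν * K := by
      rw [Real.rpow_sub_one ht0.ne', div_eq_mul_inv]
      refine mul_le_mul (Real.rpow_le_rpow ht0.le (saturate_le_two _) hν.le) ?_ (by positivity)
        (by positivity)
      exact inv_le_of_inv_le₀ hK0 hu
    have h2 : ν * t ^ (ν - 1) * saturateDeriv (y / (K * R)) ≤ ν * (2 ^ ν * K) * 1 := by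
      gcongr
      · exact hp.1
      · exact hp.2
    calc _ ≤ (K * R) ^ ν * (ν * (2 ^ ν * K) * 1) / (K * R) := by gcongr
      _ = _ := by field_simp
  · intro z hz
    have h := saturate_rpow_semiconvex hν hν2 (r := K⁻¹) (by positivity) hr1 hu
      (v := z / (K * R)) (by positivity)
    rw [← ht] at h
    have e1 : |z / (K * R) - y / (K * R)| / K⁻¹ = |z - y| / R := by
      rw [← sub_div, abs_div, abs_of_pos hS]; field_simp
    rw [e1] at h
    have h' := mul_le_mul_of_nonneg_left h (show 0 ≤ (K * R) ^ ν by positivity)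
    unfold saturatedPow
    rw [← ht]
    refine le_trans (le_of_eq ?_) (sub_le_sub_right h' (a ^ ν))
    rw [show (2 : ℝ) / K⁻¹ = 2 * K by field_simp]
    field_simp
    ring

/-! ### Lower bounds on survival probabilities -/

namespace IncrementBounds

variable {P : Kernel X X} [IsMarkovKernel P] {α β' C B x₀ : ℝ}

/-- Above R, slope times negative drift is at most of order R^(ν-1) R^(1-α), and curvature costs at
most order R^ν R^(-α): both equal R^(ν-α). -/
lemma saturatedPow_drift_far (h : IncrementBounds P α β' C B x₀) (hX : ∀ x ∈ X, 0 ≤ x)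
    (hα : 1 < α) (hα2 : α < 2) {ν m K a : ℝ} (hν : 0 < ν) (hνα : ν < α) (hm : 0 ≤ m)
    (hK : 1 ≤ K) (ha : x₀ ≤ a)
    (hμ : ∀ y : X, a < (y : ℝ) → -(m * (y : ℝ) ^ (1 - α)) ≤ drift P y) :
    ∃ E : ℝ, 0 < E ∧ ∀ R : ℝ, a ≤ R → ∀ y : X, R < (y : ℝ) →
      saturatedPow ν (K * R) a y - E * R ^ (ν - α) ≤
        ∫ z : X, saturatedPow ν (K * R) a z ∂(P y) := by
  obtain ⟨D, hD, hsc⟩ := h.le_integral_of_semiconvex hα hα2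
  have ha1 : 1 ≤ a := h.one_le.trans ha
  have hK0 : 0 < K := by linarith
  refine ⟨K ^ ν * (ν * 2 ^ ν) * m + K ^ ν * (2 ^ ν * (2 * ν + 2 * K)) * D, by positivity,
    fun R hR y hy => ?_⟩
  have hR0 : 0 < R := by linarith
  obtain ⟨p, hp0, hp, hgp⟩ := saturatedPow_semiconvex (a := a) hν (by linarith) hK hR0 hy.le
  have h1 := hsc y (by linarith) R (by linarith) (fun z => saturatedPow ν (K * R) a z) p
    ((K * R) ^ ν * (2 ^ ν * (2 * ν + 2 * K))) (by positivity)
    (integrable_saturatedPow hX hν (by positivity) (by linarith)) fun z => hgp z (hX z z.2)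
  have h2 : -(m * R ^ (1 - α)) ≤ drift P y := by
    refine le_trans ?_ (hμ y (by linarith))
    have : (y : ℝ) ^ (1 - α) ≤ R ^ (1 - α) :=
      Real.rpow_le_rpow_of_nonpos hR0 hy.le (by linarith)
    have := mul_le_mul_of_nonneg_left this hm
    linarith
  have h3 : p * (m * R ^ (1 - α)) ≤ (K * R) ^ ν * (ν * 2 ^ ν) / R * (m * R ^ (1 - α)) := by
    gcongr
  have h4 := mul_le_mul_of_nonneg_left h2 hp0
  have e1 : R ^ (1 - α) = R * R ^ (-α) := by
    rw [show 1 - α = 1 + -α by ring, Real.rpow_add hR0, Real.rpow_one]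
  have e2 : (K * R) ^ ν = K ^ ν * R ^ ν := Real.mul_rpow hK0.le hR0.le
  have e3 : R ^ (ν - α) = R ^ ν * R ^ (-α) := by
    rw [sub_eq_add_neg, Real.rpow_add hR0]
  refine le_trans ?_ h1
  have e4 : (K * R) ^ ν * (ν * 2 ^ ν) / R * (m * R ^ (1 - α)) =
      K ^ ν * (ν * 2 ^ ν) * m * R ^ (ν - α) := by
    rw [e1, e2, e3]; field_simp
  have e5 : (K * R) ^ ν * (2 ^ ν * (2 * ν + 2 * K)) * (D * R ^ (-α)) =
      K ^ ν * (2 ^ ν * (2 * ν + 2 * K)) * D * R ^ (ν - α) := by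
    rw [e2, e3]; ring
  rw [e4] at h3
  rw [e5]
  linarith

/-- Below R, saturation affects only jumps beyond KR. The resulting loss is a small multiple of
R^(ν-α) when K is large, hence paid for by the gain ε y^(ν-α) ≥ ε R^(ν-α). -/
lemma saturatedPow_drift_near (h : IncrementBounds P α β' C B x₀) (hX : ∀ x ∈ X, 0 ≤ x)
    (hα : 1 < α) (hα2 : α < 2) {ν ε a : ℝ} (hν : 0 < ν) (hνα : ν < α) (hε : 0 < ε)
    (ha : x₀ ≤ a)
    (hup : ∀ y : X, a < (y : ℝ) →
      (y : ℝ) ^ ν + ε * (y : ℝ) ^ (ν - α) ≤ ∫ z : X, (z : ℝ) ^ ν ∂(P y)) :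
    ∃ K : ℝ, 2 ≤ K ∧ ∀ R : ℝ, a ≤ R → ∀ y : X, a < (y : ℝ) → (y : ℝ) ≤ R →
      saturatedPow ν (K * R) a y ≤ ∫ z : X, saturatedPow ν (K * R) a z ∂(P y) := by
  obtain ⟨κ, hκ, hκα⟩ := exists_between (max_lt hα hνα)
  have hκ1 : 1 ≤ κ := (le_max_left _ _).trans hκ.le
  have hκν : ν < κ := (le_max_right _ _).trans_lt hκ
  obtain ⟨D, hD, hcut⟩ := h.exists_lintegral_cutPow_le hα2 hκ1 hκα
  have ha1 : 1 ≤ a := h.one_le.trans ha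
  -- Since κ > ν, the factor (K/2)^(-(κ-ν)) can be made small; K depends on ε but not on R or y.
  obtain ⟨K, hKε, hK⟩ : ∃ K : ℝ, 2 ^ ν * (K / 2) ^ (-(κ - ν)) * D < ε ∧ 2 ≤ K := by
    have h1 : Tendsto (fun K : ℝ => 2 ^ ν * (K / 2) ^ (-(κ - ν)) * D) atTop
        (𝓝 (2 ^ ν * 0 * D)) :=
      (((tendsto_rpow_neg_atTop (sub_pos.2 hκν)).comp
        (tendsto_id.atTop_div_const two_pos)).const_mul _).mul_const _
    rw [mul_zero, zero_mul] at h1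
    exact ((h1.eventually (gt_mem_nhds hε)).and (eventually_ge_atTop 2)).exists
  refine ⟨K, hK, fun R hR y hya hyR => ?_⟩
  have hR0 : 0 < R := by linarith
  have hK0 : 0 < K := by linarith
  have hS : 0 < K * R := by positivity
  have hy0 : 0 < (y : ℝ) := by linarith
  set Λ := 2 ^ ν * (K / 2) ^ (-(κ - ν)) * R ^ ν with hΛ
  have hΛ0 : 0 < Λ := by positivity
  have hi := integrable_of_lintegral_le (by fun_prop)
    (fun z => cutPow_nonneg (by positivity)) (hcut y (by linarith) R (by linarith))
  have hle := integral_le_of_lintegral_le (by fun_prop)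
    (fun z => cutPow_nonneg (by positivity)) (by positivity) (hcut y (by linarith) R (by linarith))
  have hpt : ∀ z : X, (z : ℝ) ^ ν - a ^ ν - Λ * cutPow κ (|(z : ℝ) - y| / R) ≤
      saturatedPow ν (K * R) a z := by
    intro z
    have hz := hX z z.2
    have hc : 0 ≤ Λ * cutPow κ (|(z : ℝ) - y| / R) :=
      mul_nonneg hΛ0.le (cutPow_nonneg (by positivity))
    rcases le_or_gt (z : ℝ) (K * R) with hzS | hzS
    · rw [saturatedPow_of_le hS hz hzS]; linarith
    -- The saturated function is at least -a^ν, so it suffices that the error term exceeds z^ν. As K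
    -- ≥ 2, y ≤ z/2, and the jump is at least z/2.
    · have hz0 : 0 < (z : ℝ) := hS.trans hzS
      have hyz : (y : ℝ) ≤ z / 2 := by nlinarith
      set u := |(z : ℝ) - y| / R with hu
      have hzu : (z : ℝ) ≤ 2 * R * u := by
        rw [hu, abs_of_nonneg (by linarith)]; field_simp; linarith
      have huK : K / 2 ≤ u := by nlinarith
      have hu1 : 1 ≤ u := by linarith
      have hu0 : 0 < u := by linarith
      have hcu : cutPow κ u = u ^ κ :=
        min_eq_right (Real.rpow_le_rpow_of_exponent_le hu1 (by linarith))
      have h1 : (z : ℝ) ^ ν ≤ Λ * cutPow κ u := by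
        rw [hcu, hΛ]
        calc (z : ℝ) ^ ν ≤ (2 * R * u) ^ ν := Real.rpow_le_rpow hz hzu hν.le
          _ = 2 ^ ν * R ^ ν * u ^ ν := by
            rw [Real.mul_rpow (by positivity) hu0.le, Real.mul_rpow (by norm_num) hR0.le]
          _ = 2 ^ ν * R ^ ν * (u ^ (-(κ - ν)) * u ^ κ) := by
            rw [← Real.rpow_add hu0]; congr 2; ring
          _ ≤ 2 ^ ν * R ^ ν * ((K / 2) ^ (-(κ - ν)) * u ^ κ) := by
            have : u ^ (-(κ - ν)) ≤ (K / 2) ^ (-(κ - ν)) :=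
              Real.rpow_le_rpow_of_nonpos (by positivity) huK (by linarith)
            gcongr
          _ = _ := by ring
      have h2 : 0 ≤ (K * R) ^ ν * saturate (z / (K * R)) ^ ν :=
        mul_nonneg (by positivity) (Real.rpow_nonneg (saturate_nonneg (by positivity)) _)
      rw [saturatedPow]; linarith
  have hzi := h.integrable_rpow hX hα hα2 hν hνα (x := y) (by linarith)
  have hmono := integral_mono ((hzi.sub (integrable_const (a ^ ν))).sub (hi.const_mul Λ))
    (integrable_saturatedPow (μ := P y) hX hν hS (by linarith)) hpt
  rw [integral_sub' (hzi.sub (integrable_const (a ^ ν))) (hi.const_mul Λ),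
    integral_sub' hzi (integrable_const (a ^ ν)), integral_const, integral_const_mul,
    probReal_univ, one_smul] at hmono
  rw [saturatedPow_of_le hS hy0.le (by nlinarith)]
  refine le_trans ?_ hmono
  have h1 := hup y hya
  have h2 : R ^ (ν - α) ≤ (y : ℝ) ^ (ν - α) :=
    Real.rpow_le_rpow_of_nonpos hy0 hyR (by linarith)
  have h3 : Λ * ∫ z : X, cutPow κ (|(z : ℝ) - y| / R) ∂(P y) ≤ ε * R ^ (ν - α) := by
    calc _ ≤ Λ * (D * R ^ (-α)) := by gcongr
      _ = 2 ^ ν * (K / 2) ^ (-(κ - ν)) * D * R ^ (ν - α) := by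
        rw [hΛ, sub_eq_add_neg ν α, Real.rpow_add hR0]; ring
      _ ≤ ε * R ^ (ν - α) := by gcongr
  have h4 := mul_le_mul_of_nonneg_left h2 hε.le
  linarith

/-- If `x ^ ν` has drift at least `ε x ^ (ν - α)` above `a`, the survival probabilities decay at
most like `n ^ (-ν / α)`. -/
lemma exists_le_survival (h : IncrementBounds P α β' C B x₀) (hX : ∀ x ∈ X, 0 ≤ x)
    (hα : 1 < α) (hα2 : α < 2) {ν ε m a : ℝ} (hν : 0 < ν) (hνα : ν < α) (hε : 0 < ε)
    (hm : 0 ≤ m) (ha : x₀ ≤ a)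
    (hup : ∀ y : X, a < (y : ℝ) →
      (y : ℝ) ^ ν + ε * (y : ℝ) ^ (ν - α) ≤ ∫ z : X, (z : ℝ) ^ ν ∂(P y))
    (hμ : ∀ y : X, a < (y : ℝ) → -(m * (y : ℝ) ^ (1 - α)) ≤ drift P y)
    {x : X} (hx : a < (x : ℝ)) :
    ∃ c₀ : ℝ, 0 < c₀ ∧ ∀ᶠ n : ℕ in atTop,
      ENNReal.ofReal (c₀ * (n : ℝ) ^ (-(ν / α))) ≤ survival P a n x := by
  obtain ⟨K, hK, hnear⟩ := h.saturatedPow_drift_near hX hα hα2 hν hνα hε ha hup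
  obtain ⟨E, hE, hfar⟩ := h.saturatedPow_drift_far hX hα hα2 hν hνα hm (K := K) (by linarith) ha hμ
  have ha1 : 1 ≤ a := h.one_le.trans ha
  have hα0 : 0 < α := by linarith
  have hxa : 0 < (x : ℝ) ^ ν - a ^ ν :=
    sub_pos.2 (Real.rpow_lt_rpow (by linarith) hx hν)
  refine ⟨((2 * K) ^ ν * (4 * E) ^ (ν / α))⁻¹ * (1 / 2 * ((x : ℝ) ^ ν - a ^ ν)), by positivity, ?_⟩
  have hRlim : Tendsto (fun n : ℕ => (4 * E * (n : ℝ)) ^ (1 / α)) atTop atTop :=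
    (tendsto_rpow_atTop (by positivity)).comp
      (tendsto_natCast_atTop_atTop.const_mul_atTop (by positivity))
  filter_upwards [hRlim.eventually (eventually_ge_atTop (x : ℝ)),
    ((tendsto_rpow_atTop hν).comp hRlim).eventually (eventually_ge_atTop (2 * a ^ ν)),
    eventually_ge_atTop 1] with n hRx hR2 hn
  have hn' : (1 : ℝ) ≤ n := by exact_mod_cast hn
  -- With R^α = 4En the relative loss per step, 2E R^(-α), equals 1/(2n); Bernoulli's inequality
  -- then keeps at least half of the initial value over n steps.
  set R := (4 * E * (n : ℝ)) ^ (1 / α) with hR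
  simp only [Function.comp] at hR2
  have hRa : a ≤ R := hx.le.trans hRx
  have hR0 : 0 < R := by linarith
  have hK0 : 0 < K := by linarith
  have hS : 0 < K * R := by positivity
  have hRα : R ^ (-α) = (4 * E * n)⁻¹ := by
    rw [hR, ← Real.rpow_mul (by positivity), show 1 / α * -α = -1 by field_simp,
      Real.rpow_neg_one]
  have hRν : R ^ ν = (4 * E) ^ (ν / α) * (n : ℝ) ^ (ν / α) := by
    rw [hR, ← Real.rpow_mul (by positivity), show 1 / α * ν = ν / α by ring,
      Real.mul_rpow (by positivity) (by positivity)]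
  have hρe : 2 * E * R ^ (-α) = 1 / (2 * n) := by rw [hRα]; field_simp; norm_num
  set ρ := 1 - 2 * E * R ^ (-α) with hρ
  have hρ0 : 0 ≤ ρ := by
    rw [hρ, hρe, sub_nonneg, div_le_one (by positivity)]; linarith
  have hρ1 : ρ ≤ 1 := by
    have : 0 ≤ 2 * E * R ^ (-α) := by positivity
    linarith
  have hρn : 1 / 2 ≤ ρ ^ n := by
    have h1 := one_add_mul_le_pow (a := -(1 / (2 * (n : ℝ))))
      (by have : 1 / (2 * (n : ℝ)) ≤ 1 := by
            rw [div_le_one (by positivity)]; linarith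
          linarith) n
    rw [hρ, hρe, sub_eq_add_neg]
    refine le_trans (le_of_eq ?_) h1
    field_simp; norm_num
  have hstep : ∀ y : X, a < (y : ℝ) → ENNReal.ofReal (ρ * saturatedPow ν (K * R) a y) ≤
      killedStep P a (fun z => ENNReal.ofReal (saturatedPow ν (K * R) a z)) y := by
    intro y hy
    refine le_trans ?_ (ofReal_integral_le_killedStep P
      (integrable_saturatedPow hX hν hS (by linarith)) fun z hz => ?_)
    · refine ENNReal.ofReal_le_ofReal ?_
      rcases le_or_gt (y : ℝ) R with hyR | hyR
      · refine le_trans ?_ (hnear R hRa y hy hyR)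
        refine mul_le_of_le_one_left ?_ hρ1
        rw [saturatedPow_of_le hS (hX y y.2) (by nlinarith)]
        exact sub_nonneg.2 (Real.rpow_le_rpow (by linarith) hy.le hν.le)
      · refine le_trans ?_ (hfar R hRa y hyR)
        -- As R^ν ≥ 2a^ν, the function is at least R^ν/2 above R, which turns the additive loss E
        -- R^(ν-α) into the relative loss 2E R^(-α).
        have h1 : R ^ ν / 2 ≤ saturatedPow ν (K * R) a y := by
          have h2 : R ^ ν ≤ (K * R) ^ ν * saturate (y / (K * R)) ^ ν := by
            rw [← Real.mul_rpow hS.le (saturate_nonneg (div_nonneg (hX y y.2) hS.le))]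
            refine Real.rpow_le_rpow hR0.le ?_ hν.le
            have h3 := saturate_mono (show R / (K * R) ≤ y / (K * R) by gcongr)
            rw [saturate_of_le ((div_le_one hS).2 (by nlinarith))] at h3
            calc R = K * R * (R / (K * R)) := by field_simp
              _ ≤ _ := by gcongr
          rw [saturatedPow]; linarith
        have e3 : R ^ (ν - α) = R ^ ν * R ^ (-α) := by
          rw [sub_eq_add_neg, Real.rpow_add hR0]
        rw [hρ, e3]
        have h5 : 0 ≤ E * R ^ (-α) := by positivity
        nlinarith
    · rw [saturatedPow_of_le hS (hX z z.2) (by nlinarith)]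
      exact sub_nonpos.2 (Real.rpow_le_rpow (hX z z.2) hz hν.le)
  have hmain := le_survival_of_subinvariant P (M := (2 * (K * R)) ^ ν) (by positivity) hρ0
    (g := fun z : X => saturatedPow ν (K * R) a z) (by fun_prop)
    (fun z => saturatedPow_le hν hS (by linarith) (hX z z.2)) hstep n x hx
  refine le_trans (ENNReal.ofReal_le_ofReal ?_) hmain
  rw [saturatedPow_of_le hS (hX x x.2) (by nlinarith), ← mul_assoc 2 K R,
    Real.mul_rpow (by positivity) hR0.le, hRν, Real.rpow_neg (by positivity),
    ← mul_assoc ((2 * K) ^ ν), mul_inv _ ((n : ℝ) ^ (ν / α))]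
  calc _ = ((2 * K) ^ ν * (4 * E) ^ (ν / α))⁻¹ * ((n : ℝ) ^ (ν / α))⁻¹ *
        (1 / 2 * ((x : ℝ) ^ ν - a ^ ν)) := by ring
    _ ≤ _ := by gcongr

/-- A drift bounded below by `-m x ^ (-γ)` with `γ + 1 ≤ α` keeps the chain above `a` for a time of
order `R ^ (γ + 1)` when started above `2 R`. -/
lemma exists_half_le_survival (h : IncrementBounds P α β' C B x₀)
    (hα : 1 < α) (hα2 : α < 2) {γ m a : ℝ} (hγ : 0 ≤ γ) (hγα : γ + 1 ≤ α) (hm : 0 ≤ m)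
    (ha : x₀ ≤ a) (hμ : ∀ y : X, a < (y : ℝ) → -(m * (y : ℝ) ^ (-γ)) ≤ drift P y) :
    ∃ E : ℝ, 0 < E ∧ ∀ R : ℝ, a ≤ R → ∀ n : ℕ, (n : ℝ) * (E * R ^ (-(γ + 1))) ≤ 1 / 2 →
      ∀ z : X, 2 * R ≤ (z : ℝ) → ENNReal.ofReal (1 / 2) ≤ survival P a n z := by
  obtain ⟨D, hD, hsc⟩ := h.le_integral_of_semiconvex hα hα2
  have ha1 : 1 ≤ a := h.one_le.trans ha
  -- The cutoff at scale R has slope at most 2/R, meeting a drift of at least -m R^(-γ), and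
  -- curvature cost 3D R^(-α) ≤ 3D R^(-(γ+1)).
  refine ⟨2 * m + 3 * D, by positivity, fun R hR n hn z hz => ?_⟩
  have hR0 : 0 < R := by linarith
  have hint : ∀ y : X, Integrable (fun z : X => cutoff ((z : ℝ) / R)) (P y) := fun y =>
    Integrable.of_bound (C := 1) (Measurable.aestronglyMeasurable (by fun_prop))
      (Eventually.of_forall fun z => by
        rw [Real.norm_of_nonneg (cutoff_nonneg _)]; exact cutoff_le_one _)
  have hstep : ∀ y : X, a < (y : ℝ) → ENNReal.ofReal (cutoff ((y : ℝ) / R)) ≤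
      killedStep P a (fun z => ENNReal.ofReal (cutoff ((z : ℝ) / R))) y +
        ENNReal.ofReal ((2 * m + 3 * D) * R ^ (-(γ + 1))) := by
    intro y hy
    rcases le_or_gt (y : ℝ) R with hyR | hyR
    · rw [cutoff_of_le ((div_le_one hR0).2 hyR)]; simp
    · refine le_trans ?_ (add_le_add (ofReal_integral_le_killedStep P (hint y) fun z hz =>
        (cutoff_of_le ((div_le_one hR0).2 (hz.trans hR))).le) le_rfl)
      rw [← ENNReal.ofReal_add (integral_nonneg fun z => cutoff_nonneg _) (by positivity)]
      refine ENNReal.ofReal_le_ofReal ?_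
      have hu : 1 ≤ (y : ℝ) / R := (one_le_div hR0).2 hyR.le
      have hw : max (2 - (y : ℝ) / R) 0 ≤ 1 := max_le (by linarith) zero_le_one
      have hw0 : 0 ≤ max (2 - (y : ℝ) / R) 0 := le_max_right _ _
      have h1 := hsc y (by linarith) R (by linarith) (fun z => cutoff ((z : ℝ) / R))
        (2 * max (2 - (y : ℝ) / R) 0 / R) 3 (by norm_num) (hint y) (fun z => by
          have h2 := cutoff_semiconvex hu ((z : ℝ) / R)
          rw [← sub_div, abs_div, abs_of_pos hR0] at h2
          refine le_trans (le_of_eq ?_) h2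
          ring)
      have h2 : -(m * R ^ (-γ)) ≤ drift P y := by
        refine le_trans ?_ (hμ y hy)
        have : (y : ℝ) ^ (-γ) ≤ R ^ (-γ) :=
          Real.rpow_le_rpow_of_nonpos hR0 hyR.le (by linarith)
        have := mul_le_mul_of_nonneg_left this hm
        linarith
      have h3 : 2 * max (2 - (y : ℝ) / R) 0 / R * (m * R ^ (-γ)) ≤ 2 * 1 / R * (m * R ^ (-γ)) := by
        gcongr
      have h4 := mul_le_mul_of_nonneg_left h2
        (show 0 ≤ 2 * max (2 - (y : ℝ) / R) 0 / R by positivity)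
      have e1 : R ^ (-(γ + 1)) = R ^ (-γ) / R := by
        rw [neg_add, ← sub_eq_add_neg, Real.rpow_sub_one hR0.ne']
      have h5 : R ^ (-α) ≤ R ^ (-(γ + 1)) :=
        Real.rpow_le_rpow_of_exponent_le (by linarith) (by linarith)
      have h6 : 2 * 1 / R * (m * R ^ (-γ)) = 2 * m * R ^ (-(γ + 1)) := by rw [e1]; ring
      have h7 := mul_le_mul_of_nonneg_left h5 hD.le
      rw [h6] at h3
      linarith
  have hmain := le_survival_of_additive P (g := fun z : X => cutoff ((z : ℝ) / R))
    (fun z => cutoff_le_one _) hstep n z (by linarith)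
  simp only [cutoff_of_two_le ((le_div_iff₀ hR0).2 hz), ENNReal.ofReal_one] at hmain
  have hb : (n : ℝ≥0∞) * ENNReal.ofReal ((2 * m + 3 * D) * R ^ (-(γ + 1))) ≤
      ENNReal.ofReal (1 / 2) := by
    rw [← ENNReal.ofReal_natCast, ← ENNReal.ofReal_mul (by positivity)]
    exact ENNReal.ofReal_le_ofReal hn
  have h1 : (1 : ℝ≥0∞) = ENNReal.ofReal (1 / 2) + ENNReal.ofReal (1 / 2) := by
    rw [← ENNReal.ofReal_add (by norm_num) (by norm_num)]; norm_num
  have h2 := hmain.trans (add_le_add le_rfl hb)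
  rw [h1] at h2
  exact (ENNReal.add_le_add_iff_right ENNReal.ofReal_ne_top).1 h2

end IncrementBounds

/-! ### Moments in the three regimes -/

lemma eventually_forall_gt_of_comap {p : X → Prop}
    (h : ∀ᶠ x : X in comap (fun x : X => (x : ℝ)) atTop, p x) :
    ∀ᶠ a : ℝ in atTop, ∀ x : X, a < (x : ℝ) → p x := by
  obtain ⟨r, hr⟩ := eventually_atTop.1 (eventually_comap.1 h)
  filter_upwards [eventually_ge_atTop r] with a ha x hx
  exact hr x (ha.trans hx.le) x rfl

lemma TailCondition.le_upper_tail {P : Kernel X X} {α β c : ℝ} (hT : TailCondition P α β c) :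
    ∃ x₁ y₁ : ℝ, ∀ x : X, x₁ ≤ (x : ℝ) → ∀ y : ℝ, y₁ ≤ y →
      c / 2 * y ^ (-α) ≤ (P x).real {z : X | y < max ((z : ℝ) - x) 0} := by
  have hc := hT.c_pos
  obtain ⟨x₀, hx₀, hunif, -⟩ := hT.tails
  obtain ⟨y₀, hy₀⟩ := eventually_atTop.1 (Metric.tendstoUniformlyOn_iff.1 hunif (c / 2)
    (by positivity))
  refine ⟨x₀, max y₀ 1, fun x hx y hy => ?_⟩
  have hy0 : 0 < y := lt_of_lt_of_le one_pos ((le_max_right _ _).trans hy)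
  have h1 := hy₀ y ((le_max_left _ _).trans hy) x hx
  rw [Real.dist_eq, abs_lt] at h1
  rw [Real.rpow_neg hy0.le, ← div_eq_mul_inv, div_le_iff₀ (by positivity), mul_comm _ (y ^ α)]
  linarith [h1.2]

lemma eventually_neg_le_drift {P : Kernel X X} {γ b : ℝ}
    (hD : Tendsto (fun x : X => (x : ℝ) ^ γ * drift P x)
      (comap (fun x : X => (x : ℝ)) atTop) (𝓝 b)) :
    ∀ᶠ x : X in comap (fun x : X => (x : ℝ)) atTop,
      -((|b| + 1) * (x : ℝ) ^ (-γ)) ≤ drift P x := by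
  filter_upwards [hD.eventually (lt_mem_nhds (show -(|b| + 1) < b by linarith [neg_abs_le b])),
    eventually_state_ge 1] with x hx hx1
  have hx0 : 0 < (x : ℝ) := by linarith
  rw [Real.rpow_neg hx0.le, ← div_eq_mul_inv, ← neg_div, div_le_iff₀ (by positivity), mul_comm _ _]
  linarith

variable {P : Kernel X X} [IsMarkovKernel P] {α β c : ℝ}

lemma TailCondition.eventually_passageMoment_lt_top (hT : TailCondition P α β c)
    (hX : ∀ x ∈ X, 0 ≤ x) {γ ν l q : ℝ} (hγ : 0 ≤ γ) (hν : 0 < ν) (hl : l < 0)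
    (hlim : Tendsto (fun x : X => (x : ℝ) ^ (γ + 1) *
        ((x : ℝ) ^ (-ν) * ∫ z : X, (z : ℝ) ^ ν ∂(P x) - 1))
      (comap (fun x : X => (x : ℝ)) atTop) (𝓝 l)) (hνα : ν < α)
    (hq : 0 < q) (hqν : q < ν / (γ + 1)) :
    ∀ᶠ a : ℝ in atTop, ∀ x : X, a < (x : ℝ) → passageMoment P a q x < ⊤ := by
  obtain ⟨β', C, B, x₀, h⟩ := hT.incrementBounds
  -- Half of -l leaves room for the limit to be attained eventually; the cap at 1 keeps the
  -- contraction factor nonnegative.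
  set ε := min (-l / 2) 1 with hε
  have hε0 : 0 < ε := lt_min (by linarith) one_pos
  have hlε : l < -ε := by linarith [min_le_left (-l / 2) 1]
  have hev : ∀ᶠ x : X in comap (fun x : X => (x : ℝ)) atTop,
      ∫⁻ z : X, ENNReal.ofReal ((z : ℝ) ^ ν) ∂(P x) ≤
        ENNReal.ofReal ((1 - ε * (x : ℝ) ^ (-(γ + 1))) * (x : ℝ) ^ ν) := by
    filter_upwards [hlim.eventually (gt_mem_nhds hlε), eventually_state_ge x₀,
      eventually_state_ge 1] with x hx hx₀ hx1
    have hx0 : 0 < (x : ℝ) := by linarith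
    rw [← ofReal_integral_eq_lintegral_ofReal
      (h.integrable_rpow hX hT.one_lt hT.lt_two hν hνα hx₀)
      (Eventually.of_forall fun z => Real.rpow_nonneg (hX z z.2) _)]
    refine ENNReal.ofReal_le_ofReal ?_
    have h1 : (x : ℝ) ^ (γ + 1) * (x : ℝ) ^ (-(γ + 1)) = 1 := by rw [← Real.rpow_add hx0]; simp
    have h2 : (x : ℝ) ^ ν * (x : ℝ) ^ (-ν) = 1 := by rw [← Real.rpow_add hx0]; simp
    have h3 : 0 < (x : ℝ) ^ (-(γ + 1)) := by positivity
    have h4 : 0 < (x : ℝ) ^ ν := by positivity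
    have h5 : (x : ℝ) ^ (-ν) * ∫ z : X, (z : ℝ) ^ ν ∂(P x) - 1 ≤ -ε * (x : ℝ) ^ (-(γ + 1)) := by
      have := mul_le_mul_of_nonneg_left hx.le h3.le
      rw [← mul_assoc, mul_comm _ ((x : ℝ) ^ (γ + 1)), h1, one_mul] at this
      linarith
    have h6 := mul_le_mul_of_nonneg_left h5 h4.le
    rw [mul_sub, ← mul_assoc, h2, one_mul] at h6
    linarith
  filter_upwards [eventually_forall_gt_of_comap hev, eventually_ge_atTop 1] with a ha ha1 x hx
  exact passageMoment_lt_top_of_lyapunov P hν (by linarith) hε0 (min_le_right _ _) ha1 ha hq hqν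
    x hx

/-- The critical case: mean drift of order `b x ^ (1 - α)`. -/
lemma TailCondition.eventually_passageMoment_critical (hT : TailCondition P α β c)
    (hX : ∀ x ∈ X, 0 ≤ x) {b ν : ℝ}
    (hD : Tendsto (fun x : X => (x : ℝ) ^ (α - 1) * drift P x)
      (comap (fun x : X => (x : ℝ)) atTop) (𝓝 b)) (hν : IsCriticalRoot α b c ν) {q : ℝ}
    (hq : 0 < q) :
    ∀ᶠ a : ℝ in atTop, ∀ x : X, a < (x : ℝ) →
      (q < ν / α → passageMoment P a q x < ⊤) ∧ (ν / α < q → passageMoment P a q x = ⊤) := by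
  have hα := hT.one_lt
  have hα2 := hT.lt_two
  have hc := hT.c_pos
  have hα0 : 0 < α := by linarith
  obtain ⟨hν0, hνα, hroot⟩ := (isCriticalRoot_iff hα hα2).1 hν
  have hb : b = -(c * stableDrift α ν) := by
    rw [div_eq_iff hc.ne'] at hroot; linarith
  obtain ⟨β', C, B, x₀, h⟩ := hT.incrementBounds
  -- Substituting the root equation for b gives the limit the sign of ν' - ν.
  have hlim : ∀ ν' : ℝ, 0 < ν' → ν' < α → Tendsto (fun x : X => (x : ℝ) ^ (α - 1 + 1) *
        ((x : ℝ) ^ (-ν') * ∫ z : X, (z : ℝ) ^ ν' ∂(P x) - 1))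
      (comap (fun x : X => (x : ℝ)) atTop)
      (𝓝 (ν' * c * (stableDrift α ν' - stableDrift α ν))) := by
    intro ν' h0 h1
    have h2 := h.tendsto_rpow_drift_scale hX (l := 1) hT h0 h1
      (by simp only [sub_add_cancel, sub_self, Real.rpow_zero]; exact tendsto_const_nhds) hD
    refine h2.trans (le_of_eq ?_)
    rw [hb]; congr 1; ring
  rcases lt_trichotomy q (ν / α) with hqν | hqν | hqν
  -- An exponent ν' in (qα, ν) has negative drift and still yields moments of order q.
  · obtain ⟨ν', h1, h2⟩ := exists_between ((lt_div_iff₀ hα0).1 hqν)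
    have hν' : 0 < ν' := (mul_pos hq hα0).trans h1
    have hmono := stableDrift_strictMono hα hα2 hν' h2 hνα
    filter_upwards [hT.eventually_passageMoment_lt_top hX (by linarith) hν'
      (mul_neg_of_pos_of_neg (mul_pos hν' hc) (sub_neg.2 hmono)) (hlim ν' hν' (h2.trans hνα))
      (h2.trans hνα) hq (by rw [sub_add_cancel, lt_div_iff₀ hα0]; exact h1)] with a ha x hx
    exact ⟨fun _ => ha x hx, fun hcon => absurd hcon hqν.not_gt⟩
  · exact Eventually.of_forall fun a x hx =>
      ⟨fun hcon => absurd hqν hcon.ne, fun hcon => absurd hqν hcon.ne'⟩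
  -- An exponent ν' in (ν, min(α, qα)) has positive drift, and the survival tail n^(-ν'/α) makes the
  -- moment of order q diverge.
  · obtain ⟨ν', h1, h2⟩ := exists_between (lt_min hνα ((div_lt_iff₀ hα0).1 hqν))
    have hν'α : ν' < α := h2.trans_le (min_le_left _ _)
    have hν'q : ν' < q * α := h2.trans_le (min_le_right _ _)
    have hν' : 0 < ν' := hν0.trans h1
    have hmono := stableDrift_strictMono hα hα2 hν0 h1 hν'α
    obtain ⟨ε, hε0, hε⟩ := exists_between
      (mul_pos (mul_pos hν' hc) (sub_pos.2 hmono))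
    have hup : ∀ᶠ y : X in comap (fun x : X => (x : ℝ)) atTop,
        (y : ℝ) ^ ν' + ε * (y : ℝ) ^ (ν' - α) ≤ ∫ z : X, (z : ℝ) ^ ν' ∂(P y) := by
      filter_upwards [(hlim ν' hν' hν'α).eventually (lt_mem_nhds hε), eventually_state_ge 1]
        with y hy hy1
      have hy0 : 0 < (y : ℝ) := by linarith
      rw [sub_add_cancel] at hy
      have h1 : (y : ℝ) ^ (ν' - α) * (y : ℝ) ^ α = (y : ℝ) ^ ν' := by
        rw [← Real.rpow_add hy0, sub_add_cancel]
      have h2 : (y : ℝ) ^ ν' * (y : ℝ) ^ (-ν') = 1 := by rw [← Real.rpow_add hy0]; simp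
      have h3 := mul_le_mul_of_nonneg_left hy.le (show 0 ≤ (y : ℝ) ^ (ν' - α) by positivity)
      rw [← mul_assoc, h1, mul_sub, ← mul_assoc, h2, one_mul] at h3
      linarith
    filter_upwards [eventually_forall_gt_of_comap hup,
      eventually_forall_gt_of_comap (eventually_neg_le_drift hD), eventually_ge_atTop x₀]
      with a ha1 ha2 ha3 x hx
    refine ⟨fun hcon => absurd hcon hqν.not_gt, fun _ => ?_⟩
    obtain ⟨c₀, hc₀, hsurv⟩ := h.exists_le_survival hX hα hα2 hν' hν'α hε0
      (m := |b| + 1) (by positivity) ha3 ha1 (fun y hy => by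
        have := ha2 y hy
        rwa [neg_sub] at this) hx
    exact passageMoment_eq_top P hx hq ((div_lt_iff₀ hα0).2 hν'q).le hc₀ hsurv

/-- A drift bounded below by a multiple of `-x ^ (-γ)` with `γ + 1 ≤ α` forces infinite passage
moments of order at least `α / (γ + 1)`. -/
lemma TailCondition.eventually_passageMoment_eq_top (hT : TailCondition P α β c)
    (hX : ∀ x ∈ X, 0 ≤ x) {γ b : ℝ} (hγ : 0 ≤ γ) (hγα : γ + 1 ≤ α)
    (hD : Tendsto (fun x : X => (x : ℝ) ^ γ * drift P x)
      (comap (fun x : X => (x : ℝ)) atTop) (𝓝 b)) {q : ℝ} (hq : 0 < q)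
    (hqγ : α / (γ + 1) ≤ q) :
    ∀ᶠ a : ℝ in atTop, ∀ x : X, a < (x : ℝ) → passageMoment P a q x = ⊤ := by
  have hα := hT.one_lt
  have hc := hT.c_pos
  obtain ⟨β', C, B, x₀, h⟩ := hT.incrementBounds
  obtain ⟨x₁, y₁, htail⟩ := hT.le_upper_tail
  filter_upwards [eventually_forall_gt_of_comap (eventually_neg_le_drift hD),
    eventually_ge_atTop x₀, eventually_ge_atTop x₁] with a ha hax₀ hax₁ x hx
  obtain ⟨E, hE, hhalf⟩ := h.exists_half_le_survival hα hT.lt_two hγ hγα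
    (m := |b| + 1) (by positivity) hax₀ ha
  have ha1 : 1 ≤ a := h.one_le.trans hax₀
  have hδ : 0 < γ + 1 := by linarith
  have hRlim : Tendsto (fun n : ℕ => (2 * E * (n : ℝ)) ^ (1 / (γ + 1))) atTop atTop :=
    (tendsto_rpow_atTop (by positivity)).comp
      (tendsto_natCast_atTop_atTop.const_mul_atTop (by positivity))
  have hsucc : ∀ᶠ n : ℕ in atTop, ENNReal.ofReal (c / 4 * 2 ^ (-α) *
      (2 * E) ^ (-(α / (γ + 1))) * ((n + 1 : ℕ) : ℝ) ^ (-(α / (γ + 1)))) ≤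
      survival P a (n + 1) x := by
    filter_upwards [hRlim.eventually (eventually_ge_atTop a),
      hRlim.eventually (eventually_ge_atTop y₁), eventually_ge_atTop 1] with n hRa hRy hn
    have hn' : (1 : ℝ) ≤ n := by exact_mod_cast hn
    -- This R makes n E R^(-(γ+1)) exactly 1/2. The first step jumps beyond 2R with probability at
    -- least (c/2)(2R)^(-α), and surviving n more steps costs a factor 1/2: hence c/4 and the time n
    -- + 1.
    set R := (2 * E * (n : ℝ)) ^ (1 / (γ + 1)) with hR
    have hR0 : 0 < R := by linarith
    have hRδ : R ^ (-(γ + 1)) = (2 * E * n)⁻¹ := by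
      rw [hR, ← Real.rpow_mul (by positivity), show 1 / (γ + 1) * -(γ + 1) = -1 by field_simp,
        Real.rpow_neg_one]
    have hRα : R ^ (-α) = (2 * E) ^ (-(α / (γ + 1))) * (n : ℝ) ^ (-(α / (γ + 1))) := by
      rw [hR, ← Real.rpow_mul (by positivity), show 1 / (γ + 1) * -α = -(α / (γ + 1)) by ring,
        Real.mul_rpow (by positivity) (by positivity)]
    have hsurv := hhalf R hRa n (by rw [hRδ]; field_simp; norm_num)
    have hx0 : 0 ≤ (x : ℝ) := hX x x.2
    have hset : ∀ z ∈ {z : X | 2 * R < max ((z : ℝ) - x) 0}, 2 * R ≤ (z : ℝ) := by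
      intro z hz
      have hz : 2 * R < max ((z : ℝ) - x) 0 := hz
      rcases lt_max_iff.1 hz with h1 | h1 <;> linarith
    have hms : MeasurableSet {z : X | 2 * R < max ((z : ℝ) - x) 0} :=
      measurableSet_lt measurable_const (by fun_prop)
    rw [survival_succ]
    calc _ ≤ ENNReal.ofReal (1 / 2) * P x {z : X | 2 * R < max ((z : ℝ) - x) 0} := by
          rw [← ENNReal.ofReal_toReal (measure_ne_top (P x) _),
            ← ENNReal.ofReal_mul (by norm_num)]
          refine ENNReal.ofReal_le_ofReal ?_
          have h1 := htail x (hax₁.trans hx.le) (2 * R) (by linarith)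
          rw [Real.mul_rpow (by norm_num) hR0.le, hRα] at h1
          have h2 : ((n + 1 : ℕ) : ℝ) ^ (-(α / (γ + 1))) ≤ (n : ℝ) ^ (-(α / (γ + 1))) :=
            Real.rpow_le_rpow_of_nonpos (by linarith) (by push_cast; linarith)
              (neg_nonpos.2 (by positivity))
          have h3 : c / 4 * 2 ^ (-α) * (2 * E) ^ (-(α / (γ + 1))) *
              ((n + 1 : ℕ) : ℝ) ^ (-(α / (γ + 1))) ≤ c / 4 * 2 ^ (-α) *
              (2 * E) ^ (-(α / (γ + 1))) * (n : ℝ) ^ (-(α / (γ + 1))) := by gcongr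
          have h4 : (P x).real {z : X | 2 * R < max ((z : ℝ) - x) 0} =
            (P x {z : X | 2 * R < max ((z : ℝ) - x) 0}).toReal := rfl
          rw [← h4]
          linarith
      _ = ∫⁻ z in {z : X | 2 * R < max ((z : ℝ) - x) 0}, ENNReal.ofReal (1 / 2) ∂(P x) := by
          rw [setLIntegral_const]
      _ ≤ ∫⁻ z in {z : X | 2 * R < max ((z : ℝ) - x) 0}, survival P a n z ∂(P x) :=
          setLIntegral_mono' hms fun z hz => hsurv z (hset z hz)
      _ ≤ _ := lintegral_mono_set fun z hz => by
          have := hset z hz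
          show a < (z : ℝ)
          linarith
  refine passageMoment_eq_top P hx hq hqγ (C := c / 4 * 2 ^ (-α) * (2 * E) ^ (-(α / (γ + 1))))
    (by positivity) ?_
  filter_upwards [(tendsto_sub_atTop_nat 1).eventually hsucc, eventually_ge_atTop 1] with n hn hn1
  rwa [Nat.sub_add_cancel hn1] at hn

end HalfLineChain

theorem theorem2p2 (X : Set ℝ) (hXmeas : MeasurableSet X) (hXnonneg : ∀ x ∈ X, 0 ≤ x)
    (hXunbdd : ¬ BddAbove X) (P : Kernel X X) [IsMarkovKernel P] (α β c γ b : ℝ)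
    (hT : HalfLineChain.TailCondition P α β c) (hD : HalfLineChain.DriftCondition P γ b) :
    (α - 1 < γ → ∀ q : ℝ, 0 < q → ∀ᶠ a : ℝ in atTop, ∀ x : X, a < x →
      (q < 1 / α → HalfLineChain.passageMoment P a q x < ⊤) ∧
      (1 / α < q → HalfLineChain.passageMoment P a q x = ⊤)) ∧
    (γ = α - 1 → b < c * Real.pi * |(Real.sin (Real.pi * α))⁻¹| →
      ∃ ν : ℝ, HalfLineChain.IsCriticalRoot α b c ν ∧
        (∀ ν' : ℝ, HalfLineChain.IsCriticalRoot α b c ν' → ν' = ν) ∧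
        ∀ q : ℝ, 0 < q → ∀ᶠ a : ℝ in atTop, ∀ x : X, a < x →
          (q < ν / α → HalfLineChain.passageMoment P a q x < ⊤) ∧
          (ν / α < q → HalfLineChain.passageMoment P a q x = ⊤)) ∧
    (γ < α - 1 → b < 0 → ∀ q : ℝ, 0 < q → ∀ᶠ a : ℝ in atTop, ∀ x : X, a < x →
      (q < α / (γ + 1) → HalfLineChain.passageMoment P a q x < ⊤) ∧
      (α / (γ + 1) ≤ q → HalfLineChain.passageMoment P a q x = ⊤)) := by
  have hα := hT.one_lt
  have hα2 := hT.lt_two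
  refine ⟨fun hγ q hq => ?_, fun hγ hb => ?_, fun hγ hb q hq => ?_⟩
  -- For γ > α - 1 the mean is negligible at the critical scale: this is the critical case with b =
  -- 0, whose root is ν = 1.
  · have hD' : Tendsto (fun x : X => (x : ℝ) ^ (α - 1) * HalfLineChain.drift P x)
        (comap (fun x : X => (x : ℝ)) atTop) (𝓝 0) := by
      have h1 := ((tendsto_rpow_neg_atTop (sub_pos.2 hγ)).comp
        (tendsto_comap (f := fun x : X => (x : ℝ)))).mul hD.tendsto
      rw [zero_mul] at h1
      refine h1.congr' ?_
      filter_upwards [HalfLineChain.eventually_state_ge 1] with x hx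
      have hx0 : 0 < (x : ℝ) := by linarith
      simp only [Function.comp]
      rw [← mul_assoc, ← Real.rpow_add hx0]
      congr 2; ring
    exact hT.eventually_passageMoment_critical hXnonneg hD'
      ⟨one_pos, hα, by simp⟩ hq
  · obtain ⟨ν, hν⟩ := HalfLineChain.exists_isCriticalRoot hα hα2 hT.c_pos hb
    refine ⟨ν, hν, fun ν' hν' => hν.unique hα hα2 hν', fun q hq => ?_⟩
    exact hT.eventually_passageMoment_critical hXnonneg (hγ ▸ hD.tendsto) hν hq
  · have hγ0 := hD.gamma_nonneg
    have hδ : 0 < γ + 1 := by linarith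
    rcases lt_or_ge q (α / (γ + 1)) with hlt | hge
    -- Any ν in (q(γ+1), α) works: the jump term has weight `l = 0`, leaving the negative limit νb.
    · obtain ⟨ν, h1, h2⟩ := exists_between ((lt_div_iff₀ hδ).1 hlt)
      have hν : 0 < ν := (mul_pos hq hδ).trans h1
      obtain ⟨β', C, B, x₀, h⟩ := hT.incrementBounds
      have hlim := h.tendsto_rpow_drift_scale hXnonneg (l := 0) hT hν h2
        (by simpa using tendsto_rpow_neg_atTop (show 0 < α - (γ + 1) by linarith)) hD.tendsto
      rw [zero_mul, zero_add] at hlim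
      filter_upwards [hT.eventually_passageMoment_lt_top hXnonneg hγ0 hν
        (mul_neg_of_pos_of_neg hν hb) hlim h2 hq ((lt_div_iff₀ hδ).2 h1)] with a ha x hx
      exact ⟨fun _ => ha x hx, fun hcon => absurd hcon hlt.not_ge⟩
    · filter_upwards [hT.eventually_passageMoment_eq_top hXnonneg hγ0 (by linarith) hD.tendsto hq
        hge] with a ha x hx
      exact ⟨fun hcon => absurd hcon hge.not_gt, fun _ => ha x hx⟩
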